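/- Let $T>0$, $\nu>0$ and $\chi_c\in C_0^\infty(\mathbb R)$. Put $H=L^2(\mathbb R)$, $V=H^1(\mathbb R)$, $W(V)=\{y\in L^2(0,T;V): \partial_t y\in L^2(0,T;V^*)\}$ with $\|y\|_{W(V)}^2=\|y\|_{L^2(0,T;V)}^2+\|\partial_t y\|_{L^2(0,T;V^*)}^2$, and $P=H^1(0,T)^N$ with $$\|\Phi\|_P^2=\sum_{i=1}^N h_i\int_0^T\big(|\Phi_i(t)|^2+|\partial_t\Phi_i(t)|^2\big)\,dt .$$ Let $u\in H^1(0,T)$ with $u_l\le u\le u_u$ a.e. for some real numbers $u_l\le u_u$, and let $y_0\in V$ vanish a.e. outside a bounded interval $[a,b]$. Let $\delta_\varepsilon(x)=\varepsilon^{-1}\zeta(x/\varepsilon)$, $\varepsilon>0$, where $\zeta\in C^\infty(\mathbb R)\cap L^1(\mathbb R)$ satisfies, for some integer $r\ge1$, $\int\zeta=1$, $\int x^k\zeta(x)\,dx=0$ for $1\le k\le r-1$, and $\int|x|^r|\zeta(x)|\,dx<\infty$. Let $(y_h,\Phi)\in (W(V)\cap L^\infty(0,T;V))\times P$ be a particle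 solution of the controlled viscous Burgers equation, that is, for some coefficients $\alpha_i:(0,T)\to\mathbb R$, $$y_h(x,t)=\sum_{i=1}^N\alpha_i(t)\,\delta_\varepsilon(x-\Phi_i(t)),\qquad \partial_t\Phi_i(t)=y_h(\Phi_i(t),t)\quad(i=1,\dots,N)$$ for a.e. $t\in(0,T)$; for all $\phi\in V$ and a.e. $t\in(0,T)$, $$\langle\partial_t y_h(t),\phi\rangle_{V^*,V}+\langle y_h(t)\partial_x y_h(t),\phi\rangle_H+\nu\langle\partial_x y_h(t),\partial_x\phi\rangle_H=\langle\chi_c\,u(t),\phi\rangle_H ;$$ and $\langle y_h(0),\psi\rangle_H=\langle y_0,\psi\rangle_H$ for all $\psi\in H$. Then, with $$C_{\mathrm{state}}=C\big(\|u\|_{L^2(0,T)}+\|y_0\|_V\big)\exp\!\big(C(\|u\|_{L^2(0,T)}^2+\|y_0\|_H^2)\big),$$ where $C>0$ depends only on $\nu$, $T$ and $\chi_c$, $$\|y_h\|_{L^\infty(0,T;V)}+\|y_h\|_{W(V)}\le C_{\mathrm{state}} .$$ Moreover, let $\eta>0$, suppose that the initial positions $X_i=\Phi_i(0)$ satisfy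 $a-\eta\le X_1<\dots<X_N\le b+\eta$, and let the initial point distances satisfy $0<h_i\le X_{i+1}-X_{i-1}$ for $i=1,\dots,N$, where $X_0:=a-\eta$ and $X_{N+1}:=b+\eta$. Then, with the same $C_{\mathrm{state}}$, $$\|\Phi\|_P\le C_{\mathrm{state}}+C_{\mathrm{supp}},$$ where $C_{\mathrm{supp}}>0$ depends only on $a$, $b$, $\eta$ and the fixed final time $T$ (in particular not on $\nu,\chi_c,u,y_0,\zeta,\varepsilon,N,\Phi$ or the $h_i$). -/

import Mathlib

open MeasureTheory Set
open scoped ContDiff ENNReal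

noncomputable section

namespace Burgers

/-- `g` is the weak (distributional) derivative of `f` on the open set `U ⊆ ℝ`. -/
def IsWeakDeriv (U : Set ℝ) (f g : ℝ → ℝ) : Prop :=
  ∀ φ : ℝ → ℝ, ContDiff ℝ ∞ φ → HasCompactSupport φ → tsupport φ ⊆ U →
    ∫ x, f x * deriv φ x = -∫ x, g x * φ x

/-- `H = L²(ℝ)`. -/
abbrev H : Type := Lp ℝ 2 (volume : Measure ℝ)

theorem H.integrable_mul (f : H) {φ : ℝ → ℝ} (hφ : Continuous φ) (hc : HasCompactSupport φ) :
    Integrable (fun x => f x * φ x) :=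
  (Lp.memLp f).integrable_mul (hφ.memLp_of_hasCompactSupport (p := 2) hc)

/-- The subspace of pairs `(f, f')` in `L²(ℝ) × L²(ℝ)` such that `f'` is the weak derivative of `f`,
with the inner product `⟪f, g⟫ + ⟪f', g'⟫`. -/
def sobolevSubspace : Submodule ℝ (WithLp 2 (H × H)) where
  carrier := {p | IsWeakDeriv univ p.fst p.snd}
  zero_mem' := by
    intro φ _ _ _
    have key : ∀ ψ : ℝ → ℝ, ∫ x, ((0 : H) : ℝ → ℝ) x * ψ x = 0 := by
      intro ψ
      refine integral_eq_zero_of_ae ?_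
      filter_upwards [Lp.coeFn_zero ℝ 2 (volume : Measure ℝ)] with x hx
      rw [hx, Pi.zero_apply, zero_mul]
    change ∫ x, ((0 : H) : ℝ → ℝ) x * deriv φ x = -∫ x, ((0 : H) : ℝ → ℝ) x * φ x
    rw [key, key, neg_zero]
  add_mem' := by
    intro p q hp hq φ hφ hc hs
    have hd : Continuous (deriv φ) := hφ.continuous_deriv (by simp)
    have key : ∀ (f g : H) (ψ : ℝ → ℝ), Continuous ψ → HasCompactSupport ψ →
        ∫ x, ((f + g : H) : ℝ → ℝ) x * ψ x = (∫ x, f x * ψ x) + ∫ x, g x * ψ x := by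
      intro f g ψ h1 h2
      rw [← integral_add (f.integrable_mul h1 h2) (g.integrable_mul h1 h2)]
      refine integral_congr_ae ?_
      filter_upwards [Lp.coeFn_add f g] with x hx
      rw [hx, Pi.add_apply, add_mul]
    have e1 := hp φ hφ hc hs
    have e2 := hq φ hφ hc hs
    change ∫ x, ((p.fst + q.fst : H) : ℝ → ℝ) x * deriv φ x
      = -∫ x, ((p.snd + q.snd : H) : ℝ → ℝ) x * φ x
    rw [key _ _ _ hd hc.deriv, key _ _ _ hφ.continuous hc, e1, e2]
    ring
  smul_mem' := by
    intro c p hp φ hφ hc hs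
    have key : ∀ (f : H) (ψ : ℝ → ℝ),
        ∫ x, ((c • f : H) : ℝ → ℝ) x * ψ x = c * ∫ x, f x * ψ x := by
      intro f ψ
      rw [← integral_const_mul]
      refine integral_congr_ae ?_
      filter_upwards [Lp.coeFn_smul c f] with x hx
      rw [hx, Pi.smul_apply, smul_eq_mul, mul_assoc]
    have e1 := hp φ hφ hc hs
    change ∫ x, ((c • p.fst : H) : ℝ → ℝ) x * deriv φ x
      = -∫ x, ((c • p.snd : H) : ℝ → ℝ) x * φ x
    rw [key, key, e1]
    ring

/-- `V = H¹(ℝ)`, with the inner product `⟪f, g⟫ + ⟪f', g'⟫`. -/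
def V : Type := sobolevSubspace

instance : NormedAddCommGroup V := inferInstanceAs (NormedAddCommGroup sobolevSubspace)

instance : InnerProductSpace ℝ V := inferInstanceAs (InnerProductSpace ℝ sobolevSubspace)

/-- The embedding `V ↪ H`. -/
def toH (v : V) : H := v.1.fst

/-- The spatial derivative `∂ₓ : V → H`. -/
def dx (v : V) : H := v.1.snd

/-- The dual space `V*` with the operator norm. -/
abbrev VDual : Type := V →L[ℝ] ℝ

/-- Shortcut for instance search; the structure is Mathlib's. -/
instance : ESeminormedAddMonoid VDual := inferInstance

/-- Lebesgue measure on `(0,T)`. -/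
def timeMeasure (T : ℝ) : Measure ℝ := volume.restrict (Ioo 0 T)

/-- The norm of `L²(0,T;E)`. -/
def normL2 {E : Type*} [NormedAddCommGroup E] (T : ℝ) (f : ℝ → E) : ℝ :=
  (eLpNorm f 2 (timeMeasure T)).toReal

/-- The norm of `L^∞(0,T;E)`. -/
def normLinf {E : Type*} [NormedAddCommGroup E] (T : ℝ) (f : ℝ → E) : ℝ :=
  (eLpNorm f ∞ (timeMeasure T)).toReal

/-- `y ∈ W(V)` with `∂ₜ y = dy`: `y ∈ L²(0,T;V)`, `dy ∈ L²(0,T;V*)` and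
`d/dt ⟪y, φ⟫_H = ⟨dy, φ⟩` in the sense of distributions on `(0,T)`, for all `φ ∈ V`. -/
structure MemW (T : ℝ) (y : ℝ → V) (dy : ℝ → VDual) : Prop where
  memLp : MemLp y 2 (timeMeasure T)
  memLp_deriv : MemLp dy 2 (timeMeasure T)
  weakDeriv : ∀ φ : V,
    IsWeakDeriv (Ioo 0 T) (fun t => inner ℝ (toH (y t)) (toH φ)) (fun t => dy t φ)

/-- The norm of `W(V)`, where `dy = ∂ₜ y`. -/
def normW (T : ℝ) (y : ℝ → V) (dy : ℝ → VDual) : ℝ :=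
  √(normL2 T y ^ 2 + normL2 T dy ^ 2)

/-- `f ∈ H¹(0,T)` with weak derivative `df`. -/
structure MemH1Time (T : ℝ) (f df : ℝ → ℝ) : Prop where
  memLp : MemLp f 2 (timeMeasure T)
  memLp_deriv : MemLp df 2 (timeMeasure T)
  weakDeriv : IsWeakDeriv (Ioo 0 T) f df

/-- The admissible controls: `u ∈ H¹(0,T)` with `ul ≤ u(t) ≤ uu` almost everywhere. -/
def Admissible (T ul uu : ℝ) (u : ℝ → ℝ) : Prop :=
  (∃ du, MemH1Time T u du) ∧ ∀ᵐ t ∂timeMeasure T, ul ≤ u t ∧ u t ≤ uu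

/-- `v` vanishes almost everywhere outside `[a,b]`. -/
def SupportedIn (v : V) (a b : ℝ) : Prop :=
  ∀ᵐ x : ℝ, x ∉ Icc a b → toH v x = 0

/-- A smooth kernel of order `r ≥ 1`: unit mass and vanishing moments of orders `1, …, r - 1`. -/
structure IsKernel (r : ℕ) (ζ : ℝ → ℝ) : Prop where
  one_le : 1 ≤ r
  smooth : ContDiff ℝ ∞ ζ
  integrable : Integrable ζ
  integral_eq_one : ∫ x, ζ x = 1
  moments : ∀ k : ℕ, 1 ≤ k → k ≤ r - 1 → ∫ x, x ^ k * ζ x = 0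
  integrable_moment : Integrable (fun x => |x| ^ r * |ζ x|)

/-- `δ_ε(x) = ε⁻¹ ζ(ε⁻¹ x)`. -/
def deltaEps (ζ : ℝ → ℝ) (ε : ℝ) (x : ℝ) : ℝ := ε⁻¹ * ζ (ε⁻¹ * x)

/-- `∑ᵢ αᵢ(t) δ_ε(x - Φᵢ(t))`. -/
def particleSum (ζ : ℝ → ℝ) (ε : ℝ) {N : ℕ} (α Φ : Fin N → ℝ → ℝ) (t x : ℝ) : ℝ :=
  ∑ i, α i t * deltaEps ζ ε (x - Φ i t)

/-- The initial condition `⟪y(0), ψ⟫_H = ⟪y₀, ψ⟫_H` for all `ψ ∈ H`; here `y(0)` is the value at `0`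
of the representative of `y` in `C([0,T]; H)`. -/
def HasInitialValue (T : ℝ) (y : ℝ → V) (y0 : V) : Prop :=
  ∃ z : ℝ → H, ContinuousOn z (Icc 0 T) ∧ (∀ᵐ t ∂timeMeasure T, z t = toH (y t)) ∧
    ∀ ψ : H, inner ℝ (z 0) ψ = inner ℝ (toH y0) ψ

/-- The weak viscous Burgers equation: for all `φ ∈ V` and almost every `t ∈ (0,T)`,
`⟨∂ₜ y, φ⟩ + ⟪y ∂ₓ y, φ⟫_H + ν ⟪∂ₓ y, ∂ₓ φ⟫_H = ⟪χ u(t), φ⟫_H`, with `dy = ∂ₜ y`. -/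
def WeakBurgers (ν T : ℝ) (χ u : ℝ → ℝ) (y : ℝ → V) (dy : ℝ → VDual) : Prop :=
  ∀ φ : V, ∀ᵐ t ∂timeMeasure T,
    dy t φ + (∫ x, (toH (y t) x * dx (y t) x) * toH φ x) + ν * inner ℝ (dx (y t)) (dx φ)
      = ∫ x, (χ x * u t) * toH φ x

/-- `(y, Φ) ∈ (W(V) ∩ L^∞(V)) × P` is a particle solution: `y` has the particle form with positions
`Φᵢ`, the particles move with the velocity `y`, and `y` satisfies the weak Burgers equation with
initial value `y0`.  Here `dy = ∂ₜ y` and `dΦ = ∂ₜ Φ`; `Φᵢ` denotes the continuous representative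
on `[0,T]`, so that `Φᵢ(0)` is the initial position. -/
structure IsParticleSolution (ν T : ℝ) (χ u : ℝ → ℝ) (y0 : V) (ζ : ℝ → ℝ) (ε : ℝ) {N : ℕ}
    (y : ℝ → V) (dy : ℝ → VDual) (Φ dΦ : Fin N → ℝ → ℝ) : Prop where
  memW : MemW T y dy
  memLinf : MemLp y ∞ (timeMeasure T)
  memP : ∀ i, MemH1Time T (Φ i) (dΦ i)
  continuousOn : ∀ i, ContinuousOn (Φ i) (Icc 0 T)
  particle : ∃ α : Fin N → ℝ → ℝ,
    (∀ᵐ t ∂timeMeasure T, ∀ᵐ x : ℝ, toH (y t) x = particleSum ζ ε α Φ t x) ∧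
    (∀ i, ∀ᵐ t ∂timeMeasure T, dΦ i t = particleSum ζ ε α Φ t (Φ i t))
  equation : WeakBurgers ν T χ u y dy
  initial : HasInitialValue T y y0

/-- The norm of `P = H¹(0,T)^N` with weights `h`, where `dΦ = ∂ₜ Φ`. -/
def normP (T : ℝ) {N : ℕ} (h : Fin N → ℝ) (Φ dΦ : Fin N → ℝ → ℝ) : ℝ :=
  √(∑ i, h i * (∫ t, Φ i t * Φ i t ∂timeMeasure T)
    + ∑ i, h i * (∫ t, dΦ i t * dΦ i t ∂timeMeasure T))

/-- The left neighbour of `X i`; for the first point it is the left end `A` of the interval. -/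
def leftNeighbour (A : ℝ) {N : ℕ} (X : Fin N → ℝ) (i : Fin N) : ℝ :=
  if 0 < (i : ℕ) then X ⟨(i : ℕ) - 1, lt_of_le_of_lt (Nat.sub_le _ _) i.isLt⟩ else A

/-- The right neighbour of `X i`; for the last point it is the right end `B` of the interval. -/
def rightNeighbour (B : ℝ) {N : ℕ} (X : Fin N → ℝ) (i : Fin N) : ℝ :=
  if hi : (i : ℕ) + 1 < N then X ⟨(i : ℕ) + 1, hi⟩ else B

/-- `X` is a set of initial particle positions in the neighbourhood `[a - η, b + η]` of `[a,b]`, in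
increasing order, with positive point distances `h i` that do not exceed the distance between the
two neighbours of `X i`.  This contains the usual conventions: `X (i+1) - X i`, `X i - X (i-1)`,
their mean, the spacing of a uniform grid, and the length of a cell around `X i`. -/
structure IsInitialGrid (a b η : ℝ) {N : ℕ} (X h : Fin N → ℝ) : Prop where
  strictMono : StrictMono X
  mem_Icc : ∀ i, X i ∈ Icc (a - η) (b + η)
  distance_pos : ∀ i, 0 < h i
  distance_le : ∀ i, h i ≤ rightNeighbour (b + η) X i - leftNeighbour (a - η) X i

/-- `C (‖u‖_{L²(0,T)} + ‖y₀‖_V) exp (C (‖u‖²_{L²(0,T)} + ‖y₀‖²_H))`. -/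
def Cstate (C T : ℝ) (u : ℝ → ℝ) (y0 : V) : ℝ :=
  C * (normL2 T u + ‖y0‖) * Real.exp (C * (normL2 T u ^ 2 + ‖toH y0‖ ^ 2))

end Burgers

end

namespace Burgers

/-! The state bound is the parabolic energy method. Testing with `y` kills the convection term,
because `y² ∂ₓy` is the derivative of `y³/3` and `y` vanishes at infinity (`inner_convection_self`);
Gronwall then bounds `y` in `L^∞(H) ∩ L²(V)` by the square of the data. Testing with `-∂ₓ²y`,
absorbing the second derivative in the viscosity and bounding the convection by `‖y‖_V ‖∂ₓy‖`, gives
a Gronwall inequality for `‖∂ₓy‖²` with weight `2/ν ‖y‖_V²`. The integral of this weight is already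
controlled, and it produces the exponential in the constant. The equation then bounds `∂ₜy`.

Since `y(t)` lies only in `V`, `-∂ₓ²y` is not an admissible test function, and `‖y‖²` has to be
differentiated in time with `∂ₜy` only in `V*`. Both difficulties are met with the resolvent `J = (1
- l ∂ₓ²)⁻¹` and the Yosida approximation `A = (1 - J)/l`: the forms `⟪z, J z⟫` and `⟪z, J A z⟫ = ‖∂ₓ
J z‖²` are regular enough to be differentiated (`inner_sub_inner_eq_integral`), and `l → 0` recovers
`‖y‖²` and a bound for `‖∂ₓy‖²`.

For the positions, the embedding `H¹ ⊂ L^∞` bounds each velocity by `√2 ‖y‖_V`, and the weights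
satisfy `∑ hᵢ ≤ 2(b - a + 2η)` by telescoping. With `Y = ∫ ‖y‖_V²` this gives `‖Φ‖_P² ≤ A + A Y`,
with a number `A` depending only on `a, b, η, T`. The square root is at most `Y + A + 1`: the factor
of `Y` is one, so the same state constant serves, since `Y` is also below it. -/

/-! ### Gronwall's inequality in integral form -/

/-- Telescoping over equal steps shorter than `δ` gives `F b - F a ≤ ε (G b - G a)` for every `ε`.
This replaces differentiation: increments that are small relative to those of a control function add
up to nothing. -/
theorem le_of_forall_sub_le_mul_sub {F G : ℝ → ℝ} {a b : ℝ} (hab : a ≤ b)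
    (h : ∀ ε > 0, ∃ δ > 0, ∀ s t, a ≤ s → s ≤ t → t ≤ b → t - s < δ →
      F t - F s ≤ ε * (G t - G s)) : F b ≤ F a := by
  have key : ∀ ε > 0, F b - F a ≤ ε * (G b - G a) := by
    intro ε hε
    obtain ⟨δ, hδ, H⟩ := h ε hε
    obtain ⟨n, hn⟩ := exists_nat_gt ((b - a) / δ)
    have hn0 : (0 : ℝ) < n := lt_of_le_of_lt (div_nonneg (by linarith) hδ.le) hn
    set d : ℝ := (b - a) / n with hd
    have hd0 : 0 ≤ d := div_nonneg (by linarith) hn0.le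
    have hdn : n * d = b - a := by rw [hd]; field_simp
    have hdδ : d < δ := by
      rw [hd, div_lt_iff₀ hn0]
      rwa [div_lt_iff₀ hδ, mul_comm] at hn
    have ind : ∀ k : ℕ, k ≤ n → F (a + k * d) - F a ≤ ε * (G (a + k * d) - G a) := by
      intro k
      induction k with
      | zero => intro _; simp
      | succ k ih =>
        intro hk
        have h1 := ih (by omega)
        have hkn : ((k + 1 : ℕ) : ℝ) ≤ n := by exact_mod_cast hk
        have h3 : ((k + 1 : ℕ) : ℝ) * d ≤ n * d := mul_le_mul_of_nonneg_right hkn hd0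
        have h2 := H (a + k * d) (a + (k + 1 : ℕ) * d) (by nlinarith [mul_nonneg k.cast_nonneg hd0])
          (by push_cast; nlinarith) (by linarith) (by push_cast; linarith)
        linarith
    have := ind n le_rfl
    rwa [hdn, add_sub_cancel] at this
  have : F b - F a ≤ 0 := by
    refine le_of_forall_pos_le_add fun e he => ?_
    have := key (e / (|G b - G a| + 1)) (by positivity)
    refine this.trans ?_
    have h1 : e / (|G b - G a| + 1) * (G b - G a) ≤ e / (|G b - G a| + 1) * (|G b - G a| + 1) := by
      gcongr
      linarith [le_abs_self (G b - G a)]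
    rw [div_mul_cancel₀ _ (by positivity)] at h1
    linarith
  linarith

theorem exists_delta_integral_lt {β : ℝ → ℝ} {a b : ℝ} (hab : a ≤ b)
    (hβ : IntervalIntegrable β volume a b) {ε : ℝ} (hε : 0 < ε) :
    ∃ δ > 0, ∀ s t, a ≤ s → s ≤ t → t ≤ b → t - s < δ → |∫ x in s..t, β x| < ε := by
  have hc : ContinuousOn (fun t => ∫ x in a..t, β x) (Icc a b) := by
    have := (hβ.absolutelyContinuousOnInterval_intervalIntegral (c := a) (by simp)).continuousOn
    rwa [uIcc_of_le hab] at this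
  have hu := isCompact_Icc.uniformContinuousOn_of_continuous hc
  rw [Metric.uniformContinuousOn_iff] at hu
  obtain ⟨δ, hδ, H⟩ := hu ε hε
  refine ⟨δ, hδ, fun s t has hst htb hd => ?_⟩
  have h1 := H t ⟨has.trans hst, htb⟩ s ⟨has, hst.trans htb⟩
    (by rw [Real.dist_eq, abs_of_nonneg (by linarith)]; exact hd)
  rw [Real.dist_eq] at h1
  rwa [intervalIntegral.integral_interval_sub_left] at h1
  · exact hβ.mono_set (by rw [uIcc_of_le hab, uIcc_of_le (by linarith)]; exact Icc_subset_Icc le_rfl htb)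
  · exact hβ.mono_set
      (by rw [uIcc_of_le hab, uIcc_of_le has]; exact Icc_subset_Icc le_rfl (hst.trans htb))

/-- With `G = K + ∫ β X` and `Γ = ∫ β`, the increments of `G exp (-Γ)` are bounded by a second-order
quantity in the increment of `Γ`, so the telescoping lemma shows that this product does not
increase. Only integrability of `β` is needed, and the inequality for `X` only almost everywhere. -/
theorem gronwall_integral {β X : ℝ → ℝ} {T K : ℝ} (hT : 0 ≤ T) (hK : 0 ≤ K)
    (hβ0 : ∀ t, 0 ≤ β t) (hX0 : ∀ t, 0 ≤ X t)
    (hβ : IntervalIntegrable β volume 0 T)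
    (hβX : IntervalIntegrable (fun t => β t * X t) volume 0 T)
    (h : ∀ᵐ t, t ∈ Ioc 0 T → X t ≤ K + ∫ s in (0)..t, β s * X s) :
    ∀ᵐ t, t ∈ Ioc 0 T → X t ≤ K * Real.exp (∫ s in (0)..T, β s) := by
  set G : ℝ → ℝ := fun t => K + ∫ s in (0)..t, β s * X s with hG
  set Γ : ℝ → ℝ := fun t => ∫ s in (0)..t, β s with hΓ
  have sub : ∀ {s t : ℝ}, 0 ≤ s → s ≤ t → t ≤ T → uIcc s t ⊆ uIcc 0 T := by
    intro s t h0 h1 h2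
    rw [uIcc_of_le h1, uIcc_of_le hT]
    exact Icc_subset_Icc h0 h2
  have Γsub : ∀ {s t : ℝ}, 0 ≤ s → s ≤ t → t ≤ T → Γ t - Γ s = ∫ x in s..t, β x := by
    intro s t h0 h1 h2
    exact intervalIntegral.integral_interval_sub_left (hβ.mono_set (sub le_rfl (h0.trans h1) h2))
      (hβ.mono_set (sub le_rfl h0 (h1.trans h2)))
  have Gsub : ∀ {s t : ℝ}, 0 ≤ s → s ≤ t → t ≤ T → G t - G s = ∫ x in s..t, β x * X x := by
    intro s t h0 h1 h2
    rw [← intervalIntegral.integral_interval_sub_left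
      (hβX.mono_set (sub le_rfl (h0.trans h1) h2)) (hβX.mono_set (sub le_rfl h0 (h1.trans h2)))]
    simp only [hG]; ring
  have Gmono : ∀ {s t : ℝ}, 0 ≤ s → s ≤ t → t ≤ T → G s ≤ G t := by
    intro s t h0 h1 h2
    have := Gsub h0 h1 h2
    have h3 : 0 ≤ ∫ x in s..t, β x * X x :=
      intervalIntegral.integral_nonneg h1 fun x _ => mul_nonneg (hβ0 x) (hX0 x)
    linarith
  have G0 : G 0 = K := by simp [hG]
  have Gnn : ∀ {t : ℝ}, 0 ≤ t → t ≤ T → 0 ≤ G t := fun h0 h1 => by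
    have := Gmono le_rfl h0 h1
    linarith
  have step : ∀ {s t : ℝ}, 0 ≤ s → s ≤ t → t ≤ T → G t - G s ≤ (Γ t - Γ s) * G t := by
    intro s t h0 h1 h2
    rw [Gsub h0 h1 h2, Γsub h0 h1 h2, ← intervalIntegral.integral_mul_const]
    refine intervalIntegral.integral_mono_ae_restrict h1 (hβX.mono_set (sub h0 h1 h2))
      ((hβ.mono_set (sub h0 h1 h2)).mul_const _) ?_
    have h0' : ∀ᵐ x : ℝ, x ≠ 0 := by simp [ae_iff, measure_singleton]
    filter_upwards [ae_restrict_of_ae h, ae_restrict_of_ae h0', ae_restrict_mem measurableSet_Icc]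
      with x hx hx0 hxm
    have hx1 : 0 ≤ x := h0.trans hxm.1
    refine mul_le_mul_of_nonneg_left ((hx ⟨lt_of_le_of_ne hx1 (Ne.symm hx0), hxm.2.trans h2⟩).trans
      (Gmono hx1 hxm.2 h2)) (hβ0 x)
  have Γmono : ∀ {s t : ℝ}, 0 ≤ s → s ≤ t → t ≤ T → 0 ≤ Γ t - Γ s := by
    intro s t h0 h1 h2
    rw [Γsub h0 h1 h2]
    exact intervalIntegral.integral_nonneg h1 fun x _ => hβ0 x
  have Γ0 : Γ 0 = 0 := by simp [hΓ]
  have main : ∀ t, 0 ≤ t → t ≤ T → G t * Real.exp (-Γ t) ≤ K := by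
    intro t ht0 htT
    have : G t * Real.exp (-Γ t) ≤ G 0 * Real.exp (-Γ 0) := by
      refine le_of_forall_sub_le_mul_sub (F := fun t => G t * Real.exp (-Γ t)) (G := Γ) ht0 ?_
      intro ε hε
      have hGT := Gnn hT le_rfl
      obtain ⟨δ, hδ, H⟩ := exists_delta_integral_lt hT hβ (ε := ε / (G T + 1)) (by positivity)
      refine ⟨δ, hδ, fun s r hs hsr hrt hd => ?_⟩
      have hrT := hrt.trans htT
      have h1 := H s r hs hsr hrT hd
      rw [← Γsub hs hsr hrT, abs_of_nonneg (Γmono hs hsr hrT)] at h1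
      have h2 := step hs hsr hrT
      set e := Γ r - Γ s with he
      have he0 : 0 ≤ e := Γmono hs hsr hrT
      have h3 : Real.exp (-Γ s) = Real.exp (-Γ r) * Real.exp e := by
        rw [← Real.exp_add]; congr 1; rw [he]; ring
      have h4 : 1 + e ≤ Real.exp e := by linarith [Real.add_one_le_exp e]
      have hΓr : 0 ≤ Γ r := by have := Γmono le_rfl (hs.trans hsr) hrT; rw [Γ0] at this; linarith
      have h5 : Real.exp (-Γ r) ≤ 1 := Real.exp_le_one_iff.2 (by linarith)
      have hGs := Gnn hs (hsr.trans hrT)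
      have hGr := Gnn (hs.trans hsr) hrT
      have hGrT := Gmono (hs.trans hsr) hrT le_rfl
      -- From `G s ≥ (1 - e) G r` and `exp e ≥ 1 + e`, the first-order terms cancel in `(1 - e)(1 +
      -- e) = 1 - e²`.
      have h6 : G r - G s * Real.exp e ≤ G r * e * e := by
        have : G s * (1 + e) ≤ G s * Real.exp e := by gcongr
        nlinarith
      have h7 : e * (G T + 1) ≤ ε := by
        rw [lt_div_iff₀ (by positivity)] at h1; exact h1.le
      calc G r * Real.exp (-Γ r) - G s * Real.exp (-Γ s)
          = Real.exp (-Γ r) * (G r - G s * Real.exp e) := by rw [h3]; ring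
        _ ≤ Real.exp (-Γ r) * (G r * e * e) := by gcongr
        _ ≤ 1 * (G r * e * e) := by gcongr
        _ ≤ 1 * ((G T + 1) * e * e) := by gcongr; linarith
        _ ≤ ε * e := by nlinarith
    rwa [G0, Γ0, neg_zero, Real.exp_zero, mul_one] at this
  filter_upwards [h] with t ht htm
  have h1 := main t htm.1.le htm.2
  have h2 : G t ≤ K * Real.exp (Γ t) := by
    rw [Real.exp_neg, ← div_eq_mul_inv, div_le_iff₀ (Real.exp_pos _)] at h1
    exact h1
  refine (ht htm).trans (h2.trans ?_)
  have := Γmono htm.1.le htm.2 le_rfl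
  gcongr
  linarith

/-! ### Weak derivatives in one dimension -/

theorem integral_primitive_mul_deriv {g φ : ℝ → ℝ} (hg : LocallyIntegrable g) (c : ℝ)
    (hφ : ContDiff ℝ ∞ φ) (hc : HasCompactSupport φ) :
    ∫ x, (∫ s in c..x, g s) * deriv φ x = -∫ x, g x * φ x := by
  obtain ⟨R, hR⟩ := hc.isCompact.isBounded.subset_ball 0
  have gi : ∀ a b, IntervalIntegrable g volume a b := fun a b =>
    intervalIntegrable_iff.mpr <|
      (hg.integrableOn_isCompact isCompact_uIcc).mono_set uIoc_subset_uIcc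
  set r := max (max R |c|) 1 with hr
  have hcr : c ∈ uIcc (-r) r := by
    have h1 : |c| ≤ r := (le_max_right R |c|).trans (le_max_left _ _)
    rw [uIcc_of_le (by have := abs_nonneg c; linarith)]
    exact ⟨(abs_le.1 h1).1, (abs_le.1 h1).2⟩
  have hsup : tsupport φ ⊆ Ioo (-r) r := by
    refine hR.trans ?_
    rw [Real.ball_eq_Ioo]
    have : R ≤ r := (le_max_left R |c|).trans (le_max_left _ _)
    exact Ioo_subset_Ioo (by linarith) (by linarith)
  have hout : ∀ x, x ∉ Ioo (-r) r → φ x = 0 := fun x hx => image_eq_zero_of_notMem_tsupport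
    (fun h => hx (hsup h))
  have hGac := (gi (-r) r).absolutelyContinuousOnInterval_intervalIntegral hcr
  have hφac : AbsolutelyContinuousOnInterval φ (-r) r :=
    (hφ.of_le (by simp)).contDiffOn.absolutelyContinuousOnInterval
  have e1 : ∫ x, (∫ s in c..x, g s) * deriv φ x
      = ∫ x in (-r)..r, (∫ s in c..x, g s) * deriv φ x := by
    refine (intervalIntegral.integral_eq_integral_of_support_subset ?_).symm
    intro x hx
    have : x ∈ Function.support (deriv φ) := by
      intro h0; exact hx (by simp [h0])
    exact Ioo_subset_Ioc_self (hsup (support_deriv_subset this))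
  have e2 : ∫ x, g x * φ x = ∫ x in (-r)..r, g x * φ x := by
    refine (intervalIntegral.integral_eq_integral_of_support_subset ?_).symm
    intro x hx
    have : x ∈ Function.support φ := by
      intro h0; exact hx (by simp [h0])
    exact Ioo_subset_Ioc_self (hsup (subset_tsupport _ this))
  rw [e1, e2, hGac.integral_mul_deriv_eq_deriv_mul hφac, hout r (by simp), hout (-r) (by simp)]
  simp only [mul_zero, sub_zero, zero_sub, neg_inj]
  refine intervalIntegral.integral_congr_ae ?_
  filter_upwards [LocallyIntegrable.ae_hasDerivAt_integral hg] with x hx _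
  rw [(hx c).deriv]

/-- The primitive started left of the support is zero before it, and zero after it because the mean
vanishes. Convexity of `U` keeps the hull of the support inside `U`. -/
theorem exists_primitive_hasCompactSupport {U : Set ℝ} [hU : U.OrdConnected] {ψ : ℝ → ℝ}
    (hψ : ContDiff ℝ ∞ ψ) (hc : HasCompactSupport ψ) (hs : tsupport ψ ⊆ U) (h0 : ∫ x, ψ x = 0) :
    ∃ φ : ℝ → ℝ, ContDiff ℝ ∞ φ ∧ HasCompactSupport φ ∧ tsupport φ ⊆ U ∧ deriv φ = ψ := by
  by_cases hne : (tsupport ψ).Nonempty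
  swap
  · refine ⟨fun _ => 0, contDiff_const, HasCompactSupport.zero, by simp [tsupport], ?_⟩
    rw [not_nonempty_iff_eq_empty, tsupport_eq_empty_iff] at hne
    rw [hne]
    ext x
    simp
  obtain ⟨α, hα, hα'⟩ := hc.isCompact.exists_isLeast hne
  obtain ⟨β, hβ, hβ'⟩ := hc.isCompact.exists_isGreatest hne
  have hψc : Continuous ψ := hψ.continuous
  -- The base point is `α - 1` rather than `α` so that the half-open interval of integration
  -- contains the left end `α` of the support.
  have hd : ∀ x, HasDerivAt (fun x => ∫ s in (α - 1)..x, ψ s) (ψ x) x := fun x =>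
    intervalIntegral.integral_hasDerivAt_right (hψc.intervalIntegrable _ _)
      (hψc.stronglyMeasurableAtFilter _ _) hψc.continuousAt
  have hdd : deriv (fun x => ∫ s in (α - 1)..x, ψ s) = ψ := funext fun x => (hd x).deriv
  have hsupp : Function.support (fun x => ∫ s in (α - 1)..x, ψ s) ⊆ Icc α β := by
    intro x hx
    by_contra hxm
    apply hx
    have : x < α ∨ β < x := by
      by_contra hcon
      push Not at hcon
      exact hxm ⟨hcon.1, hcon.2⟩
    rcases this with h | h
    · refine intervalIntegral.integral_zero_ae (Filter.Eventually.of_forall fun s hs => ?_)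
      refine image_eq_zero_of_notMem_tsupport fun hsm => ?_
      have := hα' hsm
      rcases mem_uIoc.1 hs with h | h <;> linarith [h.2]
    · dsimp only
      rw [← h0]
      refine intervalIntegral.integral_eq_integral_of_support_subset fun s hs => ?_
      have h1 := hα' (subset_tsupport _ hs)
      have h2 := hβ' (subset_tsupport _ hs)
      exact ⟨by linarith, by linarith⟩
  have hts : tsupport (fun x => ∫ s in (α - 1)..x, ψ s) ⊆ Icc α β :=
    closure_minimal hsupp isClosed_Icc
  refine ⟨fun x => ∫ s in (α - 1)..x, ψ s, ?_, ?_, hts.trans (hU.out (hs hα) (hs hβ)), hdd⟩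
  · rw [contDiff_infty_iff_deriv, hdd]
    exact ⟨fun x => (hd x).differentiableAt, hψ⟩
  · exact HasCompactSupport.of_support_subset_isCompact isCompact_Icc hsupp

/-- A locally integrable function with a locally integrable weak derivative on an open interval is
almost everywhere equal to a primitive of that derivative. -/
theorem IsWeakDeriv.exists_eq_add_integral {U : Set ℝ} (hUo : IsOpen U) [hU : U.OrdConnected]
    {f g : ℝ → ℝ} (hf : LocallyIntegrable f) (hg : LocallyIntegrable g)
    (h : IsWeakDeriv U f g) (x₀ : ℝ) :
    ∃ c : ℝ, ∀ᵐ x, x ∈ U → f x = c + ∫ s in x₀..x, g s := by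
  rcases U.eq_empty_or_nonempty with rfl | ⟨p, hp⟩
  · exact ⟨0, by simp⟩
  have gi : ∀ a b, IntervalIntegrable g volume a b := fun a b =>
    intervalIntegrable_iff.mpr <|
      (hg.integrableOn_isCompact isCompact_uIcc).mono_set uIoc_subset_uIcc
  have hGc : Continuous fun x => ∫ s in x₀..x, g s := intervalIntegral.continuous_primitive gi x₀
  obtain ⟨d, hd, hdU⟩ := Metric.nhds_basis_closedBall.mem_iff.1 (hUo.mem_nhds hp)
  let ρb : ContDiffBump p := ⟨d / 2, d, by positivity, by linarith⟩
  set ρ : ℝ → ℝ := ρb.normed volume with hρ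
  have hρ1 : ContDiff ℝ ∞ ρ := ρb.contDiff_normed
  have hρc : HasCompactSupport ρ := ρb.hasCompactSupport_normed
  have hρU : tsupport ρ ⊆ U := by rw [hρ, ρb.tsupport_normed_eq]; exact hdU
  have hρi : ∫ x, ρ x = 1 := ρb.integral_normed
  set k : ℝ → ℝ := fun x => f x - ∫ s in x₀..x, g s with hk
  have hkl : LocallyIntegrable k := hf.sub hGc.locallyIntegrable
  have kint : ∀ {ψ : ℝ → ℝ}, Continuous ψ → HasCompactSupport ψ →
      Integrable (fun x => k x * ψ x) := by
    intro ψ h1 h2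
    simpa [mul_comm] using hkl.integrable_smul_left_of_hasCompactSupport h1 h2
  have kd : ∀ φ : ℝ → ℝ, ContDiff ℝ ∞ φ → HasCompactSupport φ → tsupport φ ⊆ U →
      ∫ x, k x * deriv φ x = 0 := by
    intro φ h1 h2 h3
    have hdc : Continuous (deriv φ) := h1.continuous_deriv (by simp)
    have i1 : Integrable (fun x => f x * deriv φ x) := by
      simpa [mul_comm] using hf.integrable_smul_left_of_hasCompactSupport hdc h2.deriv
    have i2 : Integrable (fun x => (∫ s in x₀..x, g s) * deriv φ x) := by
      simpa [mul_comm] using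
        hGc.locallyIntegrable.integrable_smul_left_of_hasCompactSupport hdc h2.deriv
    simp only [hk, sub_mul]
    rw [integral_sub i1 i2, h φ h1 h2 h3, integral_primitive_mul_deriv hg x₀ h1 h2]
    ring
  refine ⟨∫ x, k x * ρ x, ?_⟩
  set c := ∫ x, k x * ρ x with hcdef
  have := hUo.ae_eq_zero_of_integral_contDiff_smul_eq_zero
    (f := fun x => k x - c) (μ := volume) (hkl.sub continuous_const.locallyIntegrable |>.locallyIntegrableOn U) ?_
  · filter_upwards [this] with x hx hxU
    have := hx hxU
    simp only [hk] at this
    linarith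
  intro ψ h1 h2 h3
  have hψi : Integrable ψ := h1.continuous.integrable_of_hasCompactSupport h2
  have hρint : Integrable ρ := hρ1.continuous.integrable_of_hasCompactSupport hρc
  -- The du Bois-Reymond argument: `k = f - ∫ g` has zero weak derivative, and `ψ - m ρ` has mean
  -- zero, hence is the derivative of a test function. So `k` integrates against `ψ` like the
  -- constant `c`.
  set m := ∫ x, ψ x with hm
  have hs3 : HasCompactSupport (fun x => ψ x - m * ρ x) := h2.sub (hρc.mul_left (f := fun _ => m))
  obtain ⟨φ, p1, p2, p3, p4⟩ := exists_primitive_hasCompactSupport (U := U)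
    (ψ := fun x => ψ x - m * ρ x) (h1.sub (contDiff_const.mul hρ1)) hs3
    ((tsupport_sub _ _).trans (union_subset h3 ((closure_mono
      (Function.support_const_smul_subset m ρ)).trans hρU)))
    (by rw [integral_sub hψi (hρint.const_mul m), integral_const_mul, hρi, ← hm]; ring)
  have e := kd φ p1 p2 p3
  rw [p4] at e
  have e2 : ∫ x, k x * (ψ x - m * ρ x) = (∫ x, k x * ψ x) - m * c := by
    rw [hcdef, ← integral_const_mul, ← integral_sub (kint h1.continuous h2)
      ((kint hρ1.continuous hρc).const_mul m)]
    congr 1; ext x; ring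
  rw [e2] at e
  have e3 : ∫ x, ψ x • (k x - c) = (∫ x, k x * ψ x) - c * m := by
    rw [hm, ← integral_const_mul, ← integral_sub (kint h1.continuous h2) (hψi.const_mul c)]
    congr 1; ext x; simp only [smul_eq_mul]; ring
  rw [e3, ← e]; ring

/-! ### The space `H¹(ℝ)`: completeness, embedding into bounded functions, convection -/

theorem inner_V (v w : V) : inner ℝ v w = inner ℝ (toH v) (toH w) + inner ℝ (dx v) (dx w) := rfl

theorem norm_sq_V (v : V) : ‖v‖ ^ 2 = ‖toH v‖ ^ 2 + ‖dx v‖ ^ 2 := by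
  rw [← real_inner_self_eq_norm_sq, inner_V, real_inner_self_eq_norm_sq, real_inner_self_eq_norm_sq]

theorem norm_toH_le (v : V) : ‖toH v‖ ≤ ‖v‖ := by
  refine (pow_le_pow_iff_left₀ (norm_nonneg _) (norm_nonneg _) two_ne_zero).1 ?_
  have := norm_sq_V v
  nlinarith [sq_nonneg ‖dx v‖]

theorem norm_dx_le (v : V) : ‖dx v‖ ≤ ‖v‖ := by
  refine (pow_le_pow_iff_left₀ (norm_nonneg _) (norm_nonneg _) two_ne_zero).1 ?_
  have := norm_sq_V v
  nlinarith [sq_nonneg ‖toH v‖]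

/-- The embedding `V ↪ H` as a continuous linear map. -/
noncomputable def toHL : V →L[ℝ] H :=
  LinearMap.mkContinuous ⟨⟨toH, fun _ _ => rfl⟩, fun _ _ => rfl⟩ 1 fun v => by
    rw [one_mul]; exact norm_toH_le v

/-- The spatial derivative as a continuous linear map. -/
noncomputable def dxL : V →L[ℝ] H :=
  LinearMap.mkContinuous ⟨⟨dx, fun _ _ => rfl⟩, fun _ _ => rfl⟩ 1 fun v => by
    rw [one_mul]; exact norm_dx_le v

@[simp] theorem toHL_apply (v : V) : toHL v = toH v := rfl

@[simp] theorem dxL_apply (v : V) : dxL v = dx v := rfl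

theorem H.locallyIntegrable (f : H) : LocallyIntegrable (f : ℝ → ℝ) :=
  (Lp.memLp f).locallyIntegrable (by norm_num)

theorem inner_H (f g : H) : inner ℝ f g = ∫ x, f x * g x := by
  rw [MeasureTheory.L2.inner_def]
  simp [mul_comm]

theorem H.integrable_sq (f : H) : Integrable (fun x => f x ^ 2) := (Lp.memLp f).integrable_sq

theorem H.integrable_mul_H (f g : H) : Integrable (fun x => f x * g x) :=
  (Lp.memLp f).integrable_mul (Lp.memLp g)

theorem norm_sq_H (f : H) : ‖f‖ ^ 2 = ∫ x, f x ^ 2 := by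
  rw [← real_inner_self_eq_norm_sq, inner_H]
  simp [sq]

/-- Each test function imposes a condition that is continuous in the pair. Closedness makes `V` a
Hilbert space, as needed for Lax–Milgram and for adjoints. -/
theorem isClosed_sobolevSubspace : IsClosed (sobolevSubspace : Set (WithLp 2 (H × H))) := by
  have key : (sobolevSubspace : Set (WithLp 2 (H × H))) =
      ⋂ (φ : ℝ → ℝ) (_ : ContDiff ℝ ∞ φ) (_ : HasCompactSupport φ) (_ : tsupport φ ⊆ univ),
        {p | ∫ x, p.fst x * deriv φ x = -∫ x, p.snd x * φ x} := by
    ext p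
    simp only [mem_iInter]
    rfl
  rw [key]
  refine isClosed_iInter fun φ => isClosed_iInter fun h1 => isClosed_iInter fun h2 =>
    isClosed_iInter fun _ => ?_
  have aux : ∀ {ψ : ℝ → ℝ}, Continuous ψ → HasCompactSupport ψ →
      Continuous fun f : H => ∫ x, f x * ψ x := by
    intro ψ c1 c2
    have hm : MemLp ψ 2 (volume : Measure ℝ) := c1.memLp_of_hasCompactSupport c2
    have : (fun f : H => ∫ x, f x * ψ x) = fun f : H => inner ℝ f (hm.toLp ψ) := by
      ext f
      rw [inner_H]
      refine integral_congr_ae ?_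
      filter_upwards [hm.coeFn_toLp] with x hx
      rw [hx]
    rw [this]
    fun_prop
  exact isClosed_eq ((aux (h1.continuous_deriv (by simp)) h2.deriv).comp (by fun_prop))
    ((aux h1.continuous h2).comp (by fun_prop)).neg

instance : CompleteSpace V :=
  haveI := isClosed_sobolevSubspace.completeSpace_coe
  inferInstanceAs (CompleteSpace sobolevSubspace)

instance : SecondCountableTopology V :=
  haveI : Fact ((2 : ℝ≥0∞) ≠ ⊤) := ⟨by norm_num⟩
  haveI : SecondCountableTopology (WithLp 2 (H × H)) :=
    (WithLp.prodContinuousLinearEquiv 2 ℝ H H).toHomeomorph.secondCountableTopology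
  inferInstanceAs (SecondCountableTopology sobolevSubspace)

theorem exists_continuous_rep (v : V) : ∃ w : ℝ → ℝ, (∀ᵐ x, toH v x = w x) ∧ Continuous w ∧
    ∀ a b, w b = w a + ∫ s in a..b, dx v s := by
  have hg := (dx v).locallyIntegrable
  obtain ⟨c, hc⟩ := IsWeakDeriv.exists_eq_add_integral (U := univ) isOpen_univ
    (toH v).locallyIntegrable hg v.2 0
  have gi : ∀ a b, IntervalIntegrable (dx v) volume a b := fun a b =>
    intervalIntegrable_iff.mpr <|
      (hg.integrableOn_isCompact isCompact_uIcc).mono_set uIoc_subset_uIcc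
  refine ⟨fun x => c + ∫ s in (0)..x, dx v s, ?_, ?_, ?_⟩
  · filter_upwards [hc] with x hx using hx trivial
  · exact continuous_const.add (intervalIntegral.continuous_primitive gi 0)
  · intro a b
    rw [← intervalIntegral.integral_interval_sub_left (gi 0 b) (gi 0 a)]
    ring

theorem sq_integral_le {g : ℝ → ℝ} {a b : ℝ} (hab : a ≤ b)
    (hg : IntervalIntegrable g volume a b) (hg2 : IntervalIntegrable (fun x => g x ^ 2) volume a b) :
    (∫ x in a..b, g x) ^ 2 ≤ (b - a) * ∫ x in a..b, g x ^ 2 := by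
  rcases hab.eq_or_lt with rfl | hlt
  · simp
  set I := ∫ x in a..b, g x with hI
  have h0 : 0 ≤ ∫ x in a..b, ((b - a) * g x - I) ^ 2 :=
    intervalIntegral.integral_nonneg hab fun x _ => sq_nonneg _
  have h1 : ∫ x in a..b, ((b - a) * g x - I) ^ 2
      = (b - a) * ((b - a) * (∫ x in a..b, g x ^ 2) - I ^ 2) := by
    have : (fun x => ((b - a) * g x - I) ^ 2)
        = fun x => ((b - a) ^ 2 * g x ^ 2 - 2 * (b - a) * I * g x) + I ^ 2 := by
      ext x; ring
    rw [this, intervalIntegral.integral_add ((hg2.const_mul _).sub (hg.const_mul _)) (by simp),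
      intervalIntegral.integral_sub (hg2.const_mul _) (hg.const_mul _),
      intervalIntegral.integral_const_mul, intervalIntegral.integral_const_mul, ← hI,
      intervalIntegral.integral_const, smul_eq_mul]
    ring
  rw [h1] at h0
  have := nonneg_of_mul_nonneg_right h0 (by linarith)
  linarith

/-- Average `w x = w s - ∫ dx v` over `s ∈ [x, x + 1]`, with Cauchy–Schwarz for the integral. The
local right-hand side yields both the sup bound and the decay at infinity. -/
theorem sq_rep_le {v : V} {w : ℝ → ℝ} (hw : ∀ᵐ x, toH v x = w x) (hwc : Continuous w)
    (hwi : ∀ a b, w b = w a + ∫ s in a..b, dx v s) (x : ℝ) :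
    w x ^ 2 ≤ 2 * ∫ s in x..(x + 1), (toH v s ^ 2 + dx v s ^ 2) := by
  have hx : x ≤ x + 1 := by linarith
  have i1 : IntervalIntegrable (fun s => toH v s ^ 2) volume x (x + 1) :=
    (toH v).integrable_sq.intervalIntegrable
  have i2 : ∀ a b, IntervalIntegrable (fun s => dx v s ^ 2) volume a b := fun a b =>
    (dx v).integrable_sq.intervalIntegrable
  have gi : ∀ a b, IntervalIntegrable (dx v) volume a b := fun a b =>
    intervalIntegrable_iff.mpr <|
      ((dx v).locallyIntegrable.integrableOn_isCompact isCompact_uIcc).mono_set uIoc_subset_uIcc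
  set D := ∫ s in x..(x + 1), dx v s ^ 2 with hD
  have pt : ∀ s ∈ Icc x (x + 1), w x ^ 2 ≤ 2 * w s ^ 2 + 2 * D := by
    intro s hs
    have h1 := hwi x s
    have h2 : (∫ r in x..s, dx v r) ^ 2 ≤ ∫ r in x..s, dx v r ^ 2 := by
      refine (sq_integral_le hs.1 (gi x s) (i2 x s)).trans ?_
      have : 0 ≤ ∫ r in x..s, dx v r ^ 2 :=
        intervalIntegral.integral_nonneg hs.1 fun _ _ => sq_nonneg _
      nlinarith [hs.2]
    have h3 : ∫ r in x..s, dx v r ^ 2 ≤ D :=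
      intervalIntegral.integral_mono_interval le_rfl hs.1 hs.2
        (Filter.Eventually.of_forall fun r => sq_nonneg _) (i2 _ _)
    have h4 : w x = w s - ∫ r in x..s, dx v r := by rw [h1]; ring
    rw [h4]
    nlinarith [sq_nonneg (w s + ∫ r in x..s, dx v r)]
  have h := intervalIntegral.integral_mono_on (μ := volume) hx
    (f := fun _ => w x ^ 2) (g := fun s => 2 * w s ^ 2 + 2 * D) (by simp)
    (Continuous.intervalIntegrable (by fun_prop) _ _) pt
  have e1 : ∫ s in x..(x + 1), w s ^ 2 = ∫ s in x..(x + 1), toH v s ^ 2 := by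
    refine intervalIntegral.integral_congr_ae ?_
    filter_upwards [hw] with s hs _
    rw [hs]
  have e2 : ∫ s in x..(x + 1), (2 * w s ^ 2 + 2 * D)
      = 2 * (∫ s in x..(x + 1), toH v s ^ 2) + 2 * D := by
    rw [intervalIntegral.integral_add (Continuous.intervalIntegrable (by fun_prop) _ _) (by simp),
      intervalIntegral.integral_const_mul, e1]
    simp
  rw [e2] at h
  rw [intervalIntegral.integral_add i1 (i2 _ _), mul_add]
  simpa using h

theorem sq_rep_le_norm_sq {v : V} {w : ℝ → ℝ} (hw : ∀ᵐ x, toH v x = w x) (hwc : Continuous w)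
    (hwi : ∀ a b, w b = w a + ∫ s in a..b, dx v s) (x : ℝ) : w x ^ 2 ≤ 2 * ‖v‖ ^ 2 := by
  refine (sq_rep_le hw hwc hwi x).trans ?_
  have hi := (toH v).integrable_sq.add (dx v).integrable_sq
  have : ∫ s in x..(x + 1), (toH v s ^ 2 + dx v s ^ 2) ≤ ∫ s, (toH v s ^ 2 + dx v s ^ 2) := by
    rw [intervalIntegral.integral_of_le (by linarith)]
    exact setIntegral_le_integral hi (Filter.Eventually.of_forall fun s => by simp only [Pi.zero_apply]; positivity)
  rw [integral_add (toH v).integrable_sq (dx v).integrable_sq, ← norm_sq_H, ← norm_sq_H,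
    ← norm_sq_V] at this
  linarith

theorem ae_abs_toH_le (v : V) : ∀ᵐ x, |toH v x| ≤ √2 * ‖v‖ := by
  obtain ⟨w, h1, h2, h3⟩ := exists_continuous_rep v
  filter_upwards [h1] with x hx
  rw [hx]
  refine abs_le_of_sq_le_sq ?_ (by positivity)
  rw [mul_pow, Real.sq_sqrt (by norm_num)]
  exact sq_rep_le_norm_sq h1 h2 h3 x

theorem memLp_mul_dx (v : V) : MemLp (fun x => toH v x * dx v x) 2 (volume : Measure ℝ) := by
  refine (Lp.memLp (dx v)).of_le_mul (c := √2 * ‖v‖)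
    ((Lp.aestronglyMeasurable _).mul (Lp.aestronglyMeasurable _)) ?_
  filter_upwards [ae_abs_toH_le v] with x hx
  rw [norm_mul, Real.norm_eq_abs]
  gcongr

/-- The convection term `v ∂ₓ v ∈ H`. -/
noncomputable def convection (v : V) : H := (memLp_mul_dx v).toLp _

theorem convection_coe (v : V) : ∀ᵐ x, convection v x = toH v x * dx v x :=
  (memLp_mul_dx v).coeFn_toLp

theorem norm_convection_le (v : V) : ‖convection v‖ ≤ √2 * ‖v‖ * ‖dx v‖ := by
  refine Lp.norm_le_mul_norm_of_ae_le_mul ?_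
  filter_upwards [ae_abs_toH_le v, convection_coe v] with x hx h
  rw [h, norm_mul, Real.norm_eq_abs]
  gcongr

theorem integral_convection (v : V) (f : H) :
    ∫ x, (toH v x * dx v x) * f x = inner ℝ (convection v) f := by
  rw [inner_H]
  refine integral_congr_ae ?_
  filter_upwards [convection_coe v] with x hx
  rw [hx]

theorem tendsto_rep_zero {v : V} {w : ℝ → ℝ} (hw : ∀ᵐ x, toH v x = w x) (hwc : Continuous w)
    (hwi : ∀ a b, w b = w a + ∫ s in a..b, dx v s) {l : ℕ → ℝ}
    (hl : Filter.Tendsto (fun n => ∫ s in (l n)..(l n + 1), (toH v s ^ 2 + dx v s ^ 2))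
      Filter.atTop (nhds 0)) : Filter.Tendsto (fun n => w (l n)) Filter.atTop (nhds 0) := by
  have h : Filter.Tendsto (fun n => w (l n) ^ 2) Filter.atTop (nhds 0) := by
    refine squeeze_zero (fun n => sq_nonneg _) (fun n => sq_rep_le hw hwc hwi (l n)) ?_
    simpa using hl.const_mul 2
  have h2 := h.sqrt
  simp only [Real.sqrt_sq_eq_abs, Real.sqrt_zero] at h2
  exact (tendsto_zero_iff_abs_tendsto_zero _).2 h2

/-- The integrand is the derivative of `w³/3` for the continuous representative `w`, which tends to
zero along `±n`. -/
theorem inner_convection_self (v : V) : inner ℝ (convection v) (toH v) = 0 := by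
  obtain ⟨w, h1, h2, h3⟩ := exists_continuous_rep v
  have gi : ∀ a b, IntervalIntegrable (dx v) volume a b := fun a b =>
    intervalIntegrable_iff.mpr <|
      ((dx v).locallyIntegrable.integrableOn_isCompact isCompact_uIcc).mono_set uIoc_subset_uIcc
  have hI : Integrable (fun x => convection v x * toH v x) := H.integrable_mul_H _ _
  have hF : Integrable (fun s => toH v s ^ 2 + dx v s ^ 2) :=
    (toH v).integrable_sq.add (dx v).integrable_sq
  have tn : Filter.Tendsto (fun n : ℕ => (n : ℝ)) Filter.atTop Filter.atTop :=
    tendsto_natCast_atTop_atTop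
  have tm : Filter.Tendsto (fun n : ℕ => -(n : ℝ)) Filter.atTop Filter.atBot :=
    Filter.tendsto_neg_atTop_atBot.comp tn
  have tn1 : Filter.Tendsto (fun n : ℕ => (n : ℝ) + 1) Filter.atTop Filter.atTop :=
    Filter.tendsto_atTop_add_const_right _ _ tn
  have tm1 : Filter.Tendsto (fun n : ℕ => -(n : ℝ) + 1) Filter.atTop Filter.atBot :=
    Filter.tendsto_atBot_add_const_right _ _ tm
  have lim := intervalIntegral_tendsto_integral hF tm tn
  have Fi : ∀ a b, IntervalIntegrable (fun s => toH v s ^ 2 + dx v s ^ 2) volume a b :=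
    fun a b => hF.intervalIntegrable
  have w1 : Filter.Tendsto (fun n : ℕ => w n) Filter.atTop (nhds 0) := by
    refine tendsto_rep_zero h1 h2 h3 ?_
    have := (intervalIntegral_tendsto_integral hF tm tn1).sub lim
    rw [sub_self] at this
    refine this.congr fun n => ?_
    exact intervalIntegral.integral_interval_sub_left (Fi _ _) (Fi _ _)
  have w2 : Filter.Tendsto (fun n : ℕ => w (-(n : ℝ))) Filter.atTop (nhds 0) := by
    refine tendsto_rep_zero h1 h2 h3 ?_
    have := lim.sub (intervalIntegral_tendsto_integral hF tm1 tn)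
    rw [sub_self] at this
    refine this.congr fun n => ?_
    rw [intervalIntegral.integral_interval_sub_interval_comm' (Fi _ _) (Fi _ _) (Fi _ _)]
    rw [intervalIntegral.integral_same, zero_sub, ← intervalIntegral.integral_symm]
  have cube : ∀ n : ℕ, w n ^ 3 - w (-(n : ℝ)) ^ 3
      = ∫ x in (-(n : ℝ))..n, 3 * (convection v x * toH v x) := by
    intro n
    have ac : AbsolutelyContinuousOnInterval w (-(n : ℝ)) n := by
      have := (gi (-(n : ℝ)) n).absolutelyContinuousOnInterval_intervalIntegral
        (c := -(n : ℝ)) (by simp)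
      have hc : AbsolutelyContinuousOnInterval (fun _ : ℝ => w (-(n : ℝ))) (-(n : ℝ)) n :=
        contDiffOn_const.absolutelyContinuousOnInterval
      have hk := hc.fun_add this
      have e : (fun x => w (-(n : ℝ)) + ∫ s in (-(n : ℝ))..x, dx v s) = w :=
        funext fun x => (h3 _ x).symm
      rwa [e] at hk
    have ac3 := (ac.fun_mul ac).fun_mul ac
    have e := ac3.integral_deriv_eq_sub
    have : w n ^ 3 - w (-(n : ℝ)) ^ 3
      = w n * w n * w n - w (-(n : ℝ)) * w (-(n : ℝ)) * w (-(n : ℝ)) := by ring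
    rw [this, ← e]
    refine intervalIntegral.integral_congr_ae ?_
    filter_upwards [LocallyIntegrable.ae_hasDerivAt_integral (dx v).locallyIntegrable, h1,
      convection_coe v] with x hx hx1 hx2 _
    have hd : HasDerivAt w (dx v x) x := by
      have := (hx 0).const_add (w 0)
      refine this.congr_of_eventuallyEq (Filter.Eventually.of_forall fun y => h3 0 y)
    have hd3 := (hd.mul hd).mul hd
    rw [hx2, hx1]
    refine (hd3.deriv).trans ?_
    simp only [Pi.mul_apply]
    ring
  have l1 : Filter.Tendsto (fun n : ℕ => w n ^ 3 - w (-(n : ℝ)) ^ 3) Filter.atTop (nhds 0) := by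
    simpa using (w1.pow 3).sub (w2.pow 3)
  have l2 := intervalIntegral_tendsto_integral (hI.const_mul 3) tm tn
  simp_rw [cube] at l1
  have := tendsto_nhds_unique l1 l2
  rw [integral_const_mul] at this
  rw [inner_H]
  linarith

/-- A weak derivative is determined by its function. Dually, functionals coming from `H` are dense
in `V*`. -/
theorem toH_injective : Function.Injective toH := by
  intro v v' h
  have hz : ∀ w : V, toH w = 0 → dx w = 0 := by
    intro w hw
    have hl : LocallyIntegrable (dx w : ℝ → ℝ) := (dx w).locallyIntegrable
    have : ∀ᵐ x, dx w x = 0 := by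
      refine ae_eq_zero_of_integral_contDiff_smul_eq_zero hl fun g g1 g2 => ?_
      have e := w.2 g g1 g2 (subset_univ _)
      have e0 : ∫ x, w.1.fst x * deriv g x = 0 := by
        refine integral_eq_zero_of_ae ?_
        filter_upwards [Lp.coeFn_zero ℝ 2 (volume : Measure ℝ)] with x hx
        have : w.1.fst = 0 := hw
        rw [this, hx, Pi.zero_apply, zero_mul]
      rw [e0] at e
      have : ∫ x, g x • dx w x = ∫ x, w.1.snd x * g x := by
        congr 1; ext x; rw [smul_eq_mul, mul_comm]; rfl
      rw [this]; linarith
    refine Lp.ext ?_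
    filter_upwards [this, Lp.coeFn_zero ℝ 2 (volume : Measure ℝ)] with x hx hx0
    rw [hx, hx0]; rfl
  have h0 : toH (v - v') = 0 := by
    rw [← toHL_apply, map_sub, toHL_apply, toHL_apply, h, sub_self]
  have h1 := hz _ h0
  have : ‖v - v'‖ ^ 2 = 0 := by rw [norm_sq_V, h0, h1]; simp
  exact sub_eq_zero.1 (norm_eq_zero.1 (pow_eq_zero_iff two_ne_zero |>.1 this))

/-! ### Resolvents and Yosida approximations of the second derivative -/

/-- `J = (1 - l ∂ₓ²)⁻¹`, in weak form. -/
def IsResolvent (l : ℝ) (J : H →L[ℝ] V) : Prop :=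
  ∀ (f : H) (φ : V), inner ℝ (toH (J f)) (toH φ) + l * inner ℝ (dx (J f)) (dx φ)
    = inner ℝ f (toH φ)

/-- Lax–Milgram: the form `⟪v, w⟫ + l ⟪v', w'⟫` is bounded and coercive on `V` with constant `min 1
l`. -/
theorem exists_isResolvent {l : ℝ} (hl : 0 < l) : ∃ J, IsResolvent l J := by
  let B : V →L[ℝ] V →L[ℝ] ℝ := LinearMap.mkContinuous₂
    (LinearMap.mk₂ ℝ (fun v w : V => inner ℝ (toHL v) (toHL w) + l * inner ℝ (dxL v) (dxL w))
      (fun a b c => by simp only [map_add, inner_add_left]; ring)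
      (fun c a b => by simp only [map_smul, real_inner_smul_left, smul_eq_mul]; ring)
      (fun a b c => by simp only [map_add, inner_add_right]; ring)
      (fun c a b => by simp only [map_smul, real_inner_smul_right, smul_eq_mul]; ring))
    (1 + l) (fun v w => by
      have h1 := abs_real_inner_le_norm (toH v) (toH w)
      have h2 := abs_real_inner_le_norm (dx v) (dx w)
      have h3 : ‖toH v‖ * ‖toH w‖ ≤ ‖v‖ * ‖w‖ := by
        gcongr <;> exact norm_toH_le _
      have h4 : ‖dx v‖ * ‖dx w‖ ≤ ‖v‖ * ‖w‖ := by
        gcongr <;> exact norm_dx_le _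
      simp only [LinearMap.mk₂_apply, toHL_apply, dxL_apply, Real.norm_eq_abs]
      refine (abs_add_le _ _).trans ?_
      rw [abs_mul, abs_of_pos hl]
      nlinarith)
  have hB : ∀ v w, B v w = inner ℝ (toH v) (toH w) + l * inner ℝ (dx v) (dx w) := fun v w => rfl
  have hc : IsCoercive B := by
    refine ⟨min 1 l, lt_min one_pos hl, fun u => ?_⟩
    rw [hB, real_inner_self_eq_norm_sq, real_inner_self_eq_norm_sq, mul_assoc, ← sq, norm_sq_V]
    have h1 := mul_le_mul_of_nonneg_right (min_le_left 1 l) (sq_nonneg ‖toH u‖)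
    have h2 := mul_le_mul_of_nonneg_right (min_le_right 1 l) (sq_nonneg ‖dx u‖)
    linarith
  refine ⟨hc.continuousLinearEquivOfBilin.symm.toContinuousLinearMap ∘L toHL.adjoint, ?_⟩
  intro f φ
  rw [← hB, ← hc.continuousLinearEquivOfBilin_apply]
  simp [ContinuousLinearMap.adjoint_inner_left]

/-- The Yosida approximation `(1 - J) / l` of `-∂ₓ²`. -/
noncomputable def yosida (l : ℝ) (J : H →L[ℝ] V) : H →L[ℝ] H :=
  l⁻¹ • (ContinuousLinearMap.id ℝ H - toHL ∘L J)

theorem yosida_apply (l : ℝ) (J : H →L[ℝ] V) (f : H) : yosida l J f = l⁻¹ • (f - toH (J f)) := rfl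

namespace IsResolvent

variable {l : ℝ} {J : H →L[ℝ] V}

theorem inner_symm (h : IsResolvent l J) (f g : H) :
    inner ℝ (toH (J f)) g = inner ℝ f (toH (J g)) := by
  rw [← h f (J g), real_inner_comm, ← h g (J f), real_inner_comm, real_inner_comm (dx (J f))]

theorem norm_sq_add (h : IsResolvent l J) (f : H) :
    ‖toH (J f)‖ ^ 2 + l * ‖dx (J f)‖ ^ 2 = inner ℝ f (toH (J f)) := by
  rw [← h f (J f), real_inner_self_eq_norm_sq, real_inner_self_eq_norm_sq]

theorem norm_toH_le (h : IsResolvent l J) (hl : 0 < l) (f : H) : ‖toH (J f)‖ ≤ ‖f‖ := by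
  have h1 := h.norm_sq_add f
  have h2 := real_inner_le_norm f (toH (J f))
  by_contra! hcon
  have : 0 ≤ l * ‖dx (J f)‖ ^ 2 := by positivity
  nlinarith [norm_nonneg f]

theorem inner_dx (h : IsResolvent l J) (hl : 0 < l) (f : H) (φ : V) :
    inner ℝ (dx (J f)) (dx φ) = inner ℝ (yosida l J f) (toH φ) := by
  rw [yosida_apply, real_inner_smul_left, inner_sub_left, ← h f φ]
  field_simp
  ring

theorem inner_yosida_symm (h : IsResolvent l J) (f g : H) :
    inner ℝ (yosida l J f) g = inner ℝ f (yosida l J g) := by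
  rw [yosida_apply, yosida_apply, real_inner_smul_left, real_inner_smul_right, inner_sub_left,
    inner_sub_right, h.inner_symm]

/-- Write `v = J v + l A v` and pair with `A v`. This identity gives both the contraction of `J` in
the derivative norm and the rate `√l` of convergence in `H`. -/
theorem norm_sq_dx_add (h : IsResolvent l J) (hl : 0 < l) (v : V) :
    ‖dx (J (toH v))‖ ^ 2 + l * ‖yosida l J (toH v)‖ ^ 2
      = inner ℝ (dx (J (toH v))) (dx v) := by
  have e : toH v = toH (J (toH v)) + l • yosida l J (toH v) := by
    rw [yosida_apply, smul_smul, mul_inv_cancel₀ hl.ne', one_smul]; abel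
  rw [h.inner_dx hl]
  nth_rw 4 [e]
  rw [inner_add_right, real_inner_smul_right, ← h.inner_dx hl, real_inner_self_eq_norm_sq,
    real_inner_self_eq_norm_sq]

theorem norm_dx_le (h : IsResolvent l J) (hl : 0 < l) (v : V) : ‖dx (J (toH v))‖ ≤ ‖dx v‖ := by
  have h1 := h.norm_sq_dx_add hl v
  have h2 := real_inner_le_norm (dx (J (toH v))) (dx v)
  by_contra! hcon
  have : 0 ≤ l * ‖yosida l J (toH v)‖ ^ 2 := by positivity
  nlinarith [norm_nonneg (dx v)]

theorem norm_le (h : IsResolvent l J) (hl : 0 < l) (v : V) : ‖J (toH v)‖ ≤ ‖v‖ := by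
  refine (pow_le_pow_iff_left₀ (norm_nonneg _) (norm_nonneg _) two_ne_zero).1 ?_
  rw [norm_sq_V, norm_sq_V v]
  have h1 := h.norm_toH_le hl (toH v)
  have h2 := h.norm_dx_le hl v
  gcongr

theorem norm_sub_sq_le (h : IsResolvent l J) (hl : 0 < l) (v : V) :
    ‖toH v - toH (J (toH v))‖ ^ 2 ≤ l * ‖dx v‖ ^ 2 := by
  have e : toH v - toH (J (toH v)) = l • yosida l J (toH v) := by
    rw [yosida_apply, smul_smul, mul_inv_cancel₀ hl.ne', one_smul]
  rw [e, norm_smul, mul_pow, Real.norm_eq_abs, sq_abs, sq l, mul_assoc]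
  refine mul_le_mul_of_nonneg_left ?_ hl.le
  have h1 := h.norm_sq_dx_add hl v
  have h2 := real_inner_le_norm (dx (J (toH v))) (dx v)
  have h3 := h.norm_dx_le hl v
  nlinarith [norm_nonneg (dx v), sq_nonneg ‖dx (J (toH v))‖]

/-- `⟪f, J A g⟫ = ⟪∂ₓ J f, ∂ₓ J g⟫`, where `A` is the Yosida approximation. -/
theorem inner_comp_yosida (h : IsResolvent l J) (hl : 0 < l) (f g : H) :
    inner ℝ f (toH (J (yosida l J g))) = inner ℝ (dx (J f)) (dx (J g)) := by
  rw [← h.inner_symm, real_inner_comm, ← h.inner_dx hl, real_inner_comm]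

theorem inner_dx_comp_yosida (h : IsResolvent l J) (hl : 0 < l) (v : V) :
    inner ℝ (dx v) (dx (J (yosida l J (toH v)))) = ‖yosida l J (toH v)‖ ^ 2 := by
  rw [real_inner_comm, h.inner_dx hl, h.inner_yosida_symm, real_inner_self_eq_norm_sq]

end IsResolvent

theorem tendsto_toH_resolvent {l : ℕ → ℝ} {J : ℕ → H →L[ℝ] V} (hl : ∀ n, 0 < l n)
    (hJ : ∀ n, IsResolvent (l n) (J n)) (h0 : Filter.Tendsto l Filter.atTop (nhds 0)) (v : V) :
    Filter.Tendsto (fun n => toH (J n (toH v))) Filter.atTop (nhds (toH v)) := by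
  have h1 : Filter.Tendsto (fun n => ‖toH v - toH (J n (toH v))‖ ^ 2) Filter.atTop (nhds 0) := by
    refine squeeze_zero (fun n => sq_nonneg _) (fun n => (hJ n).norm_sub_sq_le (hl n) v) ?_
    simpa using h0.mul_const (‖dx v‖ ^ 2)
  have h2 := h1.sqrt
  simp only [Real.sqrt_sq (norm_nonneg _), Real.sqrt_zero] at h2
  rw [tendsto_iff_norm_sub_tendsto_zero]
  simpa [norm_sub_rev] using h2

theorem dense_range_adjoint_toHL : (toHL.adjoint.range).topologicalClosure = ⊤ := by
  rw [Submodule.topologicalClosure_eq_top_iff, Submodule.eq_bot_iff]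
  intro v hv
  rw [Submodule.mem_orthogonal] at hv
  have := hv (toHL.adjoint (toH v)) ⟨_, rfl⟩
  rw [ContinuousLinearMap.adjoint_inner_left, toHL_apply, inner_self_eq_zero] at this
  exact toH_injective (this.trans (map_zero toHL).symm)

/-- Weak convergence in `V`: the sequence is bounded by `‖v‖` and converges in `H`, and the
functionals represented by elements of `H` are dense. -/
theorem tendsto_inner_resolvent {l : ℕ → ℝ} {J : ℕ → H →L[ℝ] V} (hl : ∀ n, 0 < l n)
    (hJ : ∀ n, IsResolvent (l n) (J n)) (h0 : Filter.Tendsto l Filter.atTop (nhds 0)) (v w : V) :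
    Filter.Tendsto (fun n => inner ℝ w (J n (toH v))) Filter.atTop (nhds (inner ℝ w v)) := by
  rw [Metric.tendsto_atTop]
  intro ε hε
  have hw : w ∈ closure (toHL.adjoint.range : Set V) := by
    have : w ∈ (toHL.adjoint.range).topologicalClosure := by
      rw [dense_range_adjoint_toHL]; trivial
    exact this
  -- Against `‖J v - v‖ ≤ 2 ‖v‖` this accuracy costs at most `ε / 2`.
  obtain ⟨_, ⟨f, rfl⟩, hf⟩ := Metric.mem_closure_iff.1 hw (ε / (4 * (‖v‖ + 1))) (by positivity)
  have ht : Filter.Tendsto (fun n => inner ℝ f (toH (J n (toH v)))) Filter.atTop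
      (nhds (inner ℝ f (toH v))) := tendsto_const_nhds.inner (tendsto_toH_resolvent hl hJ h0 v)
  obtain ⟨n0, hn0⟩ := Metric.tendsto_atTop.1 ht (ε / 2) (by positivity)
  refine ⟨n0, fun n hn => ?_⟩
  have h1 := hn0 n hn
  rw [Real.dist_eq, ← inner_sub_right] at h1 ⊢
  have e : inner ℝ w (J n (toH v) - v) = inner ℝ (w - toHL.adjoint f) (J n (toH v) - v)
      + inner ℝ f (toH (J n (toH v)) - toH v) := by
    rw [inner_sub_left, ContinuousLinearMap.adjoint_inner_left, map_sub, toHL_apply, toHL_apply]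
    ring
  rw [e]
  have h2 := abs_real_inner_le_norm (w - toHL.adjoint f) (J n (toH v) - v)
  have h3 : ‖J n (toH v) - v‖ ≤ 2 * ‖v‖ := by
    have := (hJ n).norm_le (hl n) v
    linarith [norm_sub_le (J n (toH v)) v]
  rw [dist_eq_norm] at hf
  have h4 : ‖w - toHL.adjoint f‖ * ‖J n (toH v) - v‖ ≤ ε / (4 * (‖v‖ + 1)) * (2 * (‖v‖ + 1)) := by
    have hf' : ‖w - toHL.adjoint f‖ ≤ ε / (4 * (‖v‖ + 1)) := hf.le
    gcongr
    linarith
  have h5 : ε / (4 * (‖v‖ + 1)) * (2 * (‖v‖ + 1)) = ε / 2 := by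
    field_simp; ring
  refine (abs_add_le _ _).trans_lt ?_
  linarith

theorem tendsto_inner_dx_resolvent {l : ℕ → ℝ} {J : ℕ → H →L[ℝ] V} (hl : ∀ n, 0 < l n)
    (hJ : ∀ n, IsResolvent (l n) (J n)) (h0 : Filter.Tendsto l Filter.atTop (nhds 0)) (v : V) :
    Filter.Tendsto (fun n => inner ℝ (dx v) (dx (J n (toH v)))) Filter.atTop
      (nhds (‖dx v‖ ^ 2)) := by
  have h1 := (tendsto_inner_resolvent hl hJ h0 v v).sub
    ((tendsto_const_nhds (x := toH v)).inner (𝕜 := ℝ) (tendsto_toH_resolvent hl hJ h0 v))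
  rw [inner_V, add_sub_cancel_left, real_inner_self_eq_norm_sq] at h1
  refine h1.congr fun n => ?_
  rw [inner_V, add_sub_cancel_left]

/-- Weak lower semicontinuity, which carries a bound uniform in `l` over to `v` itself. -/
theorem norm_dx_le_of_forall_resolvent {l : ℕ → ℝ} {J : ℕ → H →L[ℝ] V} (hl : ∀ n, 0 < l n)
    (hJ : ∀ n, IsResolvent (l n) (J n)) (h0 : Filter.Tendsto l Filter.atTop (nhds 0)) (v : V)
    {M : ℝ} (hM : ∀ n, ‖dx (J n (toH v))‖ ^ 2 ≤ M) : ‖dx v‖ ^ 2 ≤ M := by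
  have h1 : ‖dx v‖ ^ 2 ≤ ‖dx v‖ * √M := by
    refine le_of_tendsto (tendsto_inner_dx_resolvent hl hJ h0 v)
      (Filter.Eventually.of_forall fun n => ?_)
    refine (real_inner_le_norm _ _).trans ?_
    gcongr
    exact Real.le_sqrt_of_sq_le (hM n)
  have hM0 : 0 ≤ M := (sq_nonneg _).trans (hM 0)
  have h2 : ‖dx v‖ ≤ √M := by
    by_contra! hcon
    have := Real.sqrt_nonneg M
    nlinarith
  calc ‖dx v‖ ^ 2 ≤ √M ^ 2 := by gcongr
    _ = M := Real.sq_sqrt hM0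

/-! ### Calculus in time and differentiation of quadratic forms along weak curves -/

theorem timeMeasure_eq_Ioc (T : ℝ) : timeMeasure T = volume.restrict (Ioc 0 T) :=
  Measure.restrict_congr_set Ioo_ae_eq_Ioc

theorem timeMeasure_eq_Icc (T : ℝ) : timeMeasure T = volume.restrict (Icc 0 T) :=
  Measure.restrict_congr_set Ioo_ae_eq_Icc

instance (T : ℝ) : IsFiniteMeasure (timeMeasure T) :=
  inferInstanceAs (IsFiniteMeasure (volume.restrict (Ioo 0 T)))

theorem ae_timeMeasure_iff {T : ℝ} {p : ℝ → Prop} :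
    (∀ᵐ t ∂timeMeasure T, p t) ↔ ∀ᵐ t, t ∈ Ioc 0 T → p t := by
  rw [timeMeasure_eq_Ioc, ae_restrict_iff' measurableSet_Ioc]

theorem integral_timeMeasure {E : Type*} [NormedAddCommGroup E] [NormedSpace ℝ E] {T : ℝ}
    (hT : 0 ≤ T) (f : ℝ → E) : ∫ t, f t ∂timeMeasure T = ∫ t in (0)..T, f t := by
  rw [timeMeasure_eq_Ioc, intervalIntegral.integral_of_le hT]

theorem integrable_timeMeasure_iff {E : Type*} [NormedAddCommGroup E] {T : ℝ}
    (hT : 0 ≤ T) {f : ℝ → E} : Integrable f (timeMeasure T) ↔ IntervalIntegrable f volume 0 T := by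
  rw [timeMeasure_eq_Ioc, intervalIntegrable_iff_integrableOn_Ioc_of_le hT, IntegrableOn]

theorem uIcc_subset_of_mem {a b s t : ℝ} (h0 : a ≤ s) (h1 : s ≤ t) (h2 : t ≤ b) :
    uIcc s t ⊆ uIcc a b := by
  rw [uIcc_of_le h1, uIcc_of_le (h0.trans (h1.trans h2))]
  exact Icc_subset_Icc h0 h2

/-- The continuous representative of a function with integrable weak derivative on `(0,T)`. -/
theorem sub_eq_integral_of_isWeakDeriv {T : ℝ} (hT : 0 < T) {f df F : ℝ → ℝ}
    (hf : Integrable f (timeMeasure T)) (hdf : Integrable df (timeMeasure T))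
    (h : IsWeakDeriv (Ioo 0 T) f df) (hF : ContinuousOn F (Icc 0 T))
    (hFf : ∀ᵐ t ∂timeMeasure T, F t = f t) {s t : ℝ} (hs : s ∈ Icc 0 T) (ht : t ∈ Icc 0 T) :
    F t - F s = ∫ r in s..t, df r := by
  have key : ∀ (k φ : ℝ → ℝ), tsupport φ ⊆ Ioo 0 T →
      ∫ x, (Ioo 0 T).indicator k x * φ x = ∫ x, k x * φ x := by
    intro k φ hφ
    congr 1
    ext x
    by_cases hx : x ∈ Ioo 0 T
    · rw [indicator_of_mem hx]
    · rw [image_eq_zero_of_notMem_tsupport (fun h => hx (hφ h)), mul_zero, mul_zero]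
  have hf' : Integrable ((Ioo 0 T).indicator f) := (integrable_indicator_iff measurableSet_Ioo).2 hf
  have hdf' : Integrable ((Ioo 0 T).indicator df) :=
    (integrable_indicator_iff measurableSet_Ioo).2 hdf
  have hw : IsWeakDeriv (Ioo 0 T) ((Ioo 0 T).indicator f) ((Ioo 0 T).indicator df) := by
    intro φ h1 h2 h3
    rw [key df φ h3, key f (deriv φ) ((closure_mono support_deriv_subset).trans
      ((closure_eq_iff_isClosed.2 (isClosed_tsupport φ)).subset.trans h3))]
    exact h φ h1 h2 h3
  obtain ⟨c, hc⟩ := hw.exists_eq_add_integral isOpen_Ioo hf'.locallyIntegrable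
    hdf'.locallyIntegrable 0
  have hG : Continuous fun x => c + ∫ r in (0)..x, (Ioo 0 T).indicator df r :=
    continuous_const.add (intervalIntegral.continuous_primitive
      (fun a b => hdf'.intervalIntegrable) 0)
  have heq : EqOn F (fun x => c + ∫ r in (0)..x, (Ioo 0 T).indicator df r) (Icc 0 T) := by
    refine Measure.eqOn_Icc_of_ae_eq volume hT.ne ?_ hF hG.continuousOn
    rw [← timeMeasure_eq_Icc]
    have hc' : ∀ᵐ x ∂timeMeasure T, (Ioo 0 T).indicator f x
        = c + ∫ r in (0)..x, (Ioo 0 T).indicator df r :=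
      (ae_restrict_iff' measurableSet_Ioo).2 hc
    filter_upwards [hFf, hc', ae_restrict_mem measurableSet_Ioo] with x h1 h2 h3
    rw [h1, ← h2, indicator_of_mem h3]
  rw [heq hs, heq ht, add_sub_add_left_eq_sub, intervalIntegral.integral_interval_sub_left
    hdf'.intervalIntegrable hdf'.intervalIntegrable]
  refine intervalIntegral.integral_congr_ae ?_
  have n0 : ∀ᵐ x : ℝ, x ≠ 0 := by simp [ae_iff, measure_singleton]
  have nT : ∀ᵐ x : ℝ, x ≠ T := by simp [ae_iff, measure_singleton]
  filter_upwards [n0, nT] with x h1 h2 hx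
  have hx' : x ∈ Icc 0 T := (ordConnected_Icc.uIcc_subset hs ht) (uIoc_subset_uIcc hx)
  exact indicator_of_mem (s := Ioo 0 T) ⟨lt_of_le_of_ne hx'.1 h1.symm, lt_of_le_of_ne hx'.2 h2⟩ _

theorem intervalIntegrable_dual_apply {T : ℝ} (hT : 0 ≤ T) {z : ℝ → H}
    (hz : ContinuousOn z (Icc 0 T)) {dy : ℝ → VDual} (hdy : IntervalIntegrable dy volume 0 T)
    (B : H →L[ℝ] V) : IntervalIntegrable (fun r => dy r (B (z r))) volume 0 T := by
  rw [intervalIntegrable_iff_integrableOn_Icc_of_le hT] at hdy ⊢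
  have hBz : ContinuousOn (fun r => B (z r)) (Icc 0 T) := B.continuous.comp_continuousOn hz
  obtain ⟨M, hM⟩ := isCompact_Icc.exists_bound_of_continuousOn hBz
  refine Integrable.mono' (hdy.norm.mul_const M) ?_ ?_
  · exact isBoundedBilinearMap_apply.continuous.comp_aestronglyMeasurable₂
      hdy.aestronglyMeasurable (hBz.aestronglyMeasurable measurableSet_Icc)
  · filter_upwards [ae_restrict_mem measurableSet_Icc] with r hr
    refine ((dy r).le_opNorm _).trans ?_
    gcongr
    exact hM r hr

/-- The energy identity of a weakly differentiable curve for a regularizing quadratic form. -/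
theorem inner_sub_inner_eq_integral {T : ℝ} (hT : 0 ≤ T) {z : ℝ → H}
    (hz : ContinuousOn z (Icc 0 T)) {dy : ℝ → VDual} (hdy : IntervalIntegrable dy volume 0 T)
    (hd : ∀ (φ : V) (s t : ℝ), 0 ≤ s → s ≤ t → t ≤ T →
      inner ℝ (z t) (toH φ) - inner ℝ (z s) (toH φ) = ∫ r in s..t, dy r φ)
    {B : H →L[ℝ] V} (hB : ∀ f g, inner ℝ f (toH (B g)) = inner ℝ (toH (B f)) g)
    {t : ℝ} (ht : t ∈ Icc 0 T) :
    inner ℝ (z t) (toH (B (z t))) - inner ℝ (z 0) (toH (B (z 0)))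
      = 2 * ∫ r in (0)..t, dy r (B (z r)) := by
  set q : ℝ → ℝ := fun t => inner ℝ (z t) (toH (B (z t))) with hq
  set F : ℝ → ℝ := fun t => q t - 2 * ∫ r in (0)..t, dy r (B (z r)) with hF
  set G : ℝ → ℝ := fun t => ∫ r in (0)..t, ‖dy r‖ with hG
  have hp := intervalIntegrable_dual_apply hT hz hdy B
  have Gsub : ∀ {s t : ℝ}, 0 ≤ s → s ≤ t → t ≤ T → G t - G s = ∫ r in s..t, ‖dy r‖ := by
    intro s t h0 h1 h2
    exact intervalIntegral.integral_interval_sub_left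
      (hdy.norm.mono_set (uIcc_subset_of_mem le_rfl (h0.trans h1) h2))
      (hdy.norm.mono_set (uIcc_subset_of_mem le_rfl h0 (h1.trans h2)))
  -- By symmetry of `B` the increment of `q` is the increment of `z` tested against the fixed
  -- element `B (z t + z s)`. What remains after subtracting the integral is `z t + z s - 2 z r`,
  -- uniformly small on short intervals.
  have Fsub : ∀ {s t : ℝ}, 0 ≤ s → s ≤ t → t ≤ T →
      F t - F s = ∫ r in s..t, dy r (B (z t + z s - (2 : ℝ) • z r)) := by
    intro s t h0 h1 h2
    have hst := uIcc_subset_of_mem h0 h1 h2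
    have e1 : q t - q s = ∫ r in s..t, dy r (B (z t + z s)) := by
      rw [← hd _ s t h0 h1 h2]
      have e : toH (B (z t + z s)) = toH (B (z t)) + toH (B (z s)) := by
        rw [map_add]; exact map_add toHL _ _
      have e' : inner ℝ (z t) (toH (B (z s))) = inner ℝ (z s) (toH (B (z t))) := by
        rw [hB, real_inner_comm]
      simp only [hq, e, inner_add_right]
      rw [e']
      ring
    have e2 := intervalIntegral.integral_interval_sub_left
      (hp.mono_set (uIcc_subset_of_mem le_rfl (h0.trans h1) h2))
      (hp.mono_set (uIcc_subset_of_mem le_rfl h0 (h1.trans h2)))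
    have e3 : ∫ r in s..t, dy r (B (z t + z s - (2 : ℝ) • z r))
        = (∫ r in s..t, dy r (B (z t + z s))) - 2 * ∫ r in s..t, dy r (B (z r)) := by
      rw [← intervalIntegral.integral_const_mul, ← intervalIntegral.integral_sub
        ?_ ((hp.mono_set hst).const_mul 2)]
      · simp only [map_sub, map_smul, smul_eq_mul]
      · have := hdy.mono_set hst
        rw [intervalIntegrable_iff] at this ⊢
        exact this.apply_continuousLinearMap _
    rw [e3, ← e1, ← e2]
    simp only [hF]
    ring
  have small : ∀ ε > 0, ∃ δ > 0, ∀ s r, 0 ≤ s → s ≤ r → r ≤ t → r - s < δ →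
      |F r - F s| ≤ ε * (G r - G s) := by
    intro ε hε
    have hu := isCompact_Icc.uniformContinuousOn_of_continuous hz
    rw [Metric.uniformContinuousOn_iff] at hu
    obtain ⟨δ, hδ, hu⟩ := hu (ε / (2 * (‖B‖ + 1))) (by positivity)
    refine ⟨δ, hδ, fun s r h0 hsr hrt hd' => ?_⟩
    have hrT := hrt.trans ht.2
    have hst := uIcc_subset_of_mem h0 hsr hrT
    rw [Fsub h0 hsr hrT, Gsub h0 hsr hrT, ← intervalIntegral.integral_const_mul, ← Real.norm_eq_abs]
    refine intervalIntegral.norm_integral_le_of_norm_le hsr ?_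
      ((hdy.norm.mono_set hst).const_mul ε)
    refine Filter.Eventually.of_forall fun x hx => ?_
    have near : ∀ w ∈ Icc s r, ‖z w - z x‖ ≤ ε / (2 * (‖B‖ + 1)) := by
      intro w hw
      rw [← dist_eq_norm]
      refine (hu w ⟨h0.trans hw.1, hw.2.trans hrT⟩ x ⟨h0.trans hx.1.le, hx.2.trans hrT⟩ ?_).le
      rw [Real.dist_eq, abs_lt]
      constructor <;> linarith [hw.1, hw.2, hx.1, hx.2]
    have e : z r + z s - (2 : ℝ) • z x = (z r - z x) + (z s - z x) := by
      rw [two_smul]; abel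
    have n1 : ‖z r + z s - (2 : ℝ) • z x‖ ≤ 2 * (ε / (2 * (‖B‖ + 1))) := by
      rw [e]
      refine (norm_add_le _ _).trans ?_
      linarith [near r ⟨hsr, le_rfl⟩, near s ⟨le_rfl, hsr⟩]
    have n2 : ‖B (z r + z s - (2 : ℝ) • z x)‖ ≤ ε := by
      refine (B.le_opNorm _).trans ?_
      calc ‖B‖ * ‖z r + z s - (2 : ℝ) • z x‖ ≤ (‖B‖ + 1) * (2 * (ε / (2 * (‖B‖ + 1)))) := by
            gcongr; linarith
        _ = ε := by field_simp
    refine ((dy x).le_opNorm _).trans ?_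
    rw [mul_comm]
    gcongr
  -- The increments of `F` are negligible relative to those of `∫ ‖dy‖`, so the telescoping lemma
  -- applied to `F` and to `-F` makes `F` constant.
  have le1 : F t ≤ F 0 := by
    refine le_of_forall_sub_le_mul_sub (G := G) ht.1 fun ε hε => ?_
    obtain ⟨δ, hδ, h⟩ := small ε hε
    exact ⟨δ, hδ, fun s r h0 h1 h2 h3 => (le_abs_self _).trans (h s r h0 h1 h2 h3)⟩
  have le2 : -F t ≤ -F 0 := by
    refine le_of_forall_sub_le_mul_sub (F := fun t => -F t) (G := G) ht.1 fun ε hε => ?_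
    obtain ⟨δ, hδ, h⟩ := small ε hε
    refine ⟨δ, hδ, fun s r h0 h1 h2 h3 => le_trans ?_ (h s r h0 h1 h2 h3)⟩
    have := neg_le_abs (F r - F s)
    linarith
  have : F t = F 0 := le_antisymm le1 (neg_le_neg_iff.1 le2)
  simp only [hF, intervalIntegral.integral_same, mul_zero, sub_zero] at this
  linarith

theorem normL2_sq {E : Type*} [NormedAddCommGroup E] {T : ℝ} {f : ℝ → E}
    (hf : MemLp f 2 (timeMeasure T)) : normL2 T f ^ 2 = ∫ t, ‖f t‖ ^ 2 ∂timeMeasure T := by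
  rw [normL2, hf.eLpNorm_eq_integral_rpow_norm two_ne_zero (by norm_num)]
  have h0 : 0 ≤ ∫ t, ‖f t‖ ^ 2 ∂timeMeasure T := integral_nonneg fun _ => sq_nonneg _
  simp only [ENNReal.toReal_ofNat, Real.rpow_two]
  rw [ENNReal.toReal_ofReal (by positivity), ← Real.rpow_natCast, ← Real.rpow_mul h0]
  norm_num

theorem normLinf_le {E : Type*} [NormedAddCommGroup E] {T M : ℝ} {f : ℝ → E} (hM : 0 ≤ M)
    (h : ∀ᵐ t ∂timeMeasure T, ‖f t‖ ≤ M) : normLinf T f ≤ M := by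
  rw [normLinf, eLpNorm_exponent_top]
  exact ENNReal.toReal_le_of_le_ofReal hM (eLpNormEssSup_le_of_ae_bound h)

/-! ### Energy estimates for the viscous Burgers equation -/

/-- A solution of the viscous Burgers equation with source `u(t) χ`, with its representative `z` in
`C([0,T]; H)`; the weak equation holds for almost every time with all test functions. -/
structure IsBurgersSolution (ν T : ℝ) (χ : H) (u : ℝ → ℝ) (y0 : V) (y : ℝ → V) (dy : ℝ → VDual)
    (z : ℝ → H) : Prop where
  memLp : MemLp y 2 (timeMeasure T)
  memLp_deriv : MemLp dy 2 (timeMeasure T)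
  memLinf : MemLp y ∞ (timeMeasure T)
  memLp_control : MemLp u 2 (timeMeasure T)
  continuousOn : ContinuousOn z (Icc 0 T)
  ae_eq : ∀ᵐ t ∂timeMeasure T, z t = toH (y t)
  initial : z 0 = toH y0
  sub_eq : ∀ (φ : V) (s t : ℝ), 0 ≤ s → s ≤ t → t ≤ T →
    inner ℝ (z t) (toH φ) - inner ℝ (z s) (toH φ) = ∫ r in s..t, dy r φ
  equation : ∀ᵐ t ∂timeMeasure T, ∀ φ : V,
    dy t φ = inner ℝ (u t • χ - convection (y t)) (toH φ) - ν * inner ℝ (dx (y t)) (dx φ)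

/-- Separability of `V` exchanges the quantifiers: one null set serves a countable dense family, and
both sides are continuous in `φ`. Only then may `φ` depend on `t`, as in `J (z t)`. -/
theorem WeakBurgers.ae_forall {ν T : ℝ} {χ u : ℝ → ℝ} {y : ℝ → V} {dy : ℝ → VDual}
    (h : WeakBurgers ν T χ u y dy) (hχ : MemLp χ 2 (volume : Measure ℝ)) :
    ∀ᵐ t ∂timeMeasure T, ∀ φ : V,
      dy t φ = inner ℝ (u t • hχ.toLp χ - convection (y t)) (toH φ)
        - ν * inner ℝ (dx (y t)) (dx φ) := by
  have h1 : ∀ᵐ t ∂timeMeasure T, ∀ n : ℕ, dy t (TopologicalSpace.denseSeq V n) =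
      inner ℝ (u t • hχ.toLp χ - convection (y t)) (toH (TopologicalSpace.denseSeq V n))
        - ν * inner ℝ (dx (y t)) (dx (TopologicalSpace.denseSeq V n)) := by
    rw [ae_all_iff]
    intro n
    filter_upwards [h (TopologicalSpace.denseSeq V n)] with t ht
    set φ := TopologicalSpace.denseSeq V n
    have e : ∫ x, (χ x * u t) * toH φ x = u t * inner ℝ (hχ.toLp χ) (toH φ) := by
      rw [inner_H, ← integral_const_mul]
      refine integral_congr_ae ?_
      filter_upwards [hχ.coeFn_toLp] with x hx
      rw [hx]; ring
    rw [integral_convection, e] at ht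
    rw [inner_sub_left, real_inner_smul_left]
    linarith
  filter_upwards [h1] with t ht φ
  have hc : Continuous fun φ : V => inner ℝ (u t • hχ.toLp χ - convection (y t)) (toHL φ)
        - ν * inner ℝ (dx (y t)) (dxL φ) := by fun_prop
  have := Continuous.ext_on (TopologicalSpace.denseRange_denseSeq V) (dy t).continuous hc
    (by rintro _ ⟨n, rfl⟩; exact ht n)
  exact congrFun this φ

theorem IsParticleSolution.exists_isBurgersSolution {ν T : ℝ} (hT : 0 < T) {χ u : ℝ → ℝ} {y0 : V}
    {ζ : ℝ → ℝ} {ε : ℝ} {N : ℕ} {y : ℝ → V} {dy : ℝ → VDual} {Φ dΦ : Fin N → ℝ → ℝ}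
    (h : IsParticleSolution ν T χ u y0 ζ ε y dy Φ dΦ) (hχ : MemLp χ 2 (volume : Measure ℝ))
    (hu : MemLp u 2 (timeMeasure T)) :
    ∃ z, IsBurgersSolution ν T (hχ.toLp χ) u y0 y dy z := by
  obtain ⟨z, hz, hzy, hz0⟩ := h.initial
  refine ⟨z, h.memW.memLp, h.memW.memLp_deriv, h.memLinf, hu, hz, hzy, ext_inner_right ℝ hz0, ?_,
    h.equation.ae_forall hχ⟩
  intro φ s t h0 h1 h2
  have i1 : Integrable y (timeMeasure T) := h.memW.memLp.integrable (by norm_num)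
  have i2 : Integrable dy (timeMeasure T) := h.memW.memLp_deriv.integrable (by norm_num)
  refine sub_eq_integral_of_isWeakDeriv (F := fun t => inner ℝ (z t) (toH φ)) hT ?_
    (i2.apply_continuousLinearMap φ) (h.memW.weakDeriv φ) ?_ ?_ ⟨h0, h1.trans h2⟩ ⟨h0.trans h1, h2⟩
  · exact (toHL.integrable_comp i1).inner_const (𝕜 := ℝ) (toH φ)
  · exact hz.inner continuousOn_const
  · filter_upwards [hzy] with t ht
    rw [ht]

namespace IsBurgersSolution

variable {ν T : ℝ} {χ : H} {u : ℝ → ℝ} {y0 : V} {y : ℝ → V} {dy : ℝ → VDual} {z : ℝ → H}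

/-- This `M` serves only for integrability and dominated convergence; it never enters an estimate's
constant. -/
theorem exists_bound (h : IsBurgersSolution ν T χ u y0 y dy z) :
    ∃ M : ℝ, 0 ≤ M ∧ ∀ᵐ t ∂timeMeasure T, ‖y t‖ ≤ M := by
  refine ⟨(eLpNorm y ⊤ (timeMeasure T)).toReal, ENNReal.toReal_nonneg, ?_⟩
  have h2 := h.memLinf.eLpNorm_ne_top
  filter_upwards [ae_le_eLpNormEssSup (f := y) (μ := timeMeasure T)] with t ht
  rw [← eLpNorm_exponent_top] at ht
  have := ENNReal.toReal_mono h2 ht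
  simpa using this

theorem aesm_dx (h : IsBurgersSolution ν T χ u y0 y dy z) :
    AEStronglyMeasurable (fun t => dx (y t)) (timeMeasure T) :=
  dxL.continuous.comp_aestronglyMeasurable h.memLp.1

theorem aesm_toH (h : IsBurgersSolution ν T χ u y0 y dy z) :
    AEStronglyMeasurable (fun t => toH (y t)) (timeMeasure T) :=
  toHL.continuous.comp_aestronglyMeasurable h.memLp.1

theorem integrable_norm_sq (h : IsBurgersSolution ν T χ u y0 y dy z) :
    Integrable (fun t => ‖y t‖ ^ 2) (timeMeasure T) :=
  h.memLp.integrable_norm_pow two_ne_zero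

theorem integrable_norm_sq_dx (h : IsBurgersSolution ν T χ u y0 y dy z) :
    Integrable (fun t => ‖dx (y t)‖ ^ 2) (timeMeasure T) := by
  refine h.integrable_norm_sq.mono' (h.aesm_dx.norm.pow 2) (Filter.Eventually.of_forall fun t => ?_)
  rw [Real.norm_eq_abs, abs_of_nonneg (sq_nonneg _)]
  have := norm_dx_le (y t)
  gcongr

theorem integrable_norm_sq_toH (h : IsBurgersSolution ν T χ u y0 y dy z) :
    Integrable (fun t => ‖toH (y t)‖ ^ 2) (timeMeasure T) := by
  refine h.integrable_norm_sq.mono' (h.aesm_toH.norm.pow 2)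
    (Filter.Eventually.of_forall fun t => ?_)
  rw [Real.norm_eq_abs, abs_of_nonneg (sq_nonneg _)]
  have := norm_toH_le (y t)
  gcongr

theorem integrable_control_sq (h : IsBurgersSolution ν T χ u y0 y dy z) :
    Integrable (fun t => u t ^ 2) (timeMeasure T) := h.memLp_control.integrable_sq

theorem integrable_mul_sq_dx (h : IsBurgersSolution ν T χ u y0 y dy z) :
    Integrable (fun t => ‖y t‖ ^ 2 * ‖dx (y t)‖ ^ 2) (timeMeasure T) := by
  obtain ⟨M, hM0, hM⟩ := h.exists_bound
  refine (h.integrable_norm_sq_dx.const_mul (M ^ 2)).mono'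
    ((h.memLp.1.norm.pow 2).mul (h.aesm_dx.norm.pow 2)) ?_
  filter_upwards [hM] with t ht
  rw [Real.norm_eq_abs, abs_of_nonneg (by positivity)]
  gcongr

theorem integrable_control_mul (h : IsBurgersSolution ν T χ u y0 y dy z) :
    Integrable (fun t => u t * inner ℝ χ (toH (y t))) (timeMeasure T) := by
  refine ((h.integrable_control_sq.const_mul (‖χ‖ ^ 2)).add h.integrable_norm_sq_toH).mono'
    (h.memLp_control.1.mul (aestronglyMeasurable_const.inner h.aesm_toH))
    (Filter.Eventually.of_forall fun t => ?_)
  have := abs_real_inner_le_norm χ (toH (y t))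
  rw [Real.norm_eq_abs, abs_mul, Pi.add_apply]
  have h2 : |u t| * |inner ℝ χ (toH (y t))| ≤ |u t| * (‖χ‖ * ‖toH (y t)‖) := by gcongr
  nlinarith [sq_nonneg (‖χ‖ * |u t| - ‖toH (y t)‖), sq_abs (u t), sq_nonneg (‖χ‖ * |u t|),
    sq_nonneg ‖toH (y t)‖]

theorem control_mul_le (s : ℝ) (v : V) :
    2 * (s * inner ℝ χ (toH v)) ≤ ‖χ‖ ^ 2 * s ^ 2 + ‖toH v‖ ^ 2 := by
  have := abs_real_inner_le_norm χ (toH v)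
  have h2 : |s| * |inner ℝ χ (toH v)| ≤ |s| * (‖χ‖ * ‖toH v‖) := by gcongr
  have h3 := le_abs_self (s * inner ℝ χ (toH v))
  rw [abs_mul] at h3
  nlinarith [sq_nonneg (‖χ‖ * |s| - ‖toH v‖), sq_abs s]

theorem norm_forcing_sq_le (s : ℝ) (v : V) :
    ‖s • χ - convection v‖ ^ 2 ≤ 2 * ‖χ‖ ^ 2 * s ^ 2 + 4 * (‖v‖ ^ 2 * ‖dx v‖ ^ 2) := by
  have h1 := norm_sub_le (s • χ) (convection v)
  rw [norm_smul, Real.norm_eq_abs] at h1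
  have h2 := norm_convection_le v
  have h3 : ‖convection v‖ ^ 2 ≤ 2 * (‖v‖ ^ 2 * ‖dx v‖ ^ 2) := by
    calc ‖convection v‖ ^ 2 ≤ (√2 * ‖v‖ * ‖dx v‖) ^ 2 := by gcongr
      _ = 2 * (‖v‖ ^ 2 * ‖dx v‖ ^ 2) := by
        rw [mul_pow, mul_pow, Real.sq_sqrt (by norm_num)]; ring
  have h4 : ‖s • χ - convection v‖ ^ 2 ≤ (|s| * ‖χ‖ + ‖convection v‖) ^ 2 := by gcongr
  nlinarith [sq_nonneg (|s| * ‖χ‖ - ‖convection v‖), sq_abs s]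

/-- Dominated convergence, with `‖dy r‖ M` as majorant since `J` contracts the norm of `V`. The
convection term disappears in the limit, where it is tested with `y` itself. -/
theorem tendsto_energy (hT : 0 < T) (h : IsBurgersSolution ν T χ u y0 y dy z)
    {l : ℕ → ℝ} {J : ℕ → H →L[ℝ] V} (hl : ∀ n, 0 < l n)
    (hJ : ∀ n, IsResolvent (l n) (J n)) (h0 : Filter.Tendsto l Filter.atTop (nhds 0))
    {t : ℝ} (ht : t ∈ Icc 0 T) :
    Filter.Tendsto (fun n => ∫ r in (0)..t, dy r (J n (z r))) Filter.atTop
      (nhds (∫ r in (0)..t, (u r * inner ℝ χ (toH (y r)) - ν * ‖dx (y r)‖ ^ 2))) := by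
  obtain ⟨M, hM0, hM⟩ := h.exists_bound
  have hdy : IntervalIntegrable dy volume 0 T :=
    (integrable_timeMeasure_iff hT.le).1 (h.memLp_deriv.integrable (by norm_num))
  have hst := uIcc_subset_of_mem le_rfl ht.1 ht.2
  have sub : ∀ {x}, x ∈ uIoc 0 t → x ∈ Ioc 0 T := by
    intro x hx
    rw [uIoc_of_le ht.1] at hx
    exact ⟨hx.1, hx.2.trans ht.2⟩
  refine intervalIntegral.tendsto_integral_filter_of_dominated_convergence (fun r => ‖dy r‖ * M)
    (Filter.Eventually.of_forall fun n => ?_) (Filter.Eventually.of_forall fun n => ?_)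
    ((hdy.mono_set hst).norm.mul_const M) ?_
  · have := (intervalIntegrable_dual_apply hT.le h.continuousOn hdy (J n)).mono_set hst
    exact this.aestronglyMeasurable_restrict_uIoc
  · filter_upwards [ae_timeMeasure_iff.1 hM, ae_timeMeasure_iff.1 h.ae_eq] with r h1 h2 hr
    refine ((dy r).le_opNorm _).trans ?_
    rw [h2 (sub hr)]
    gcongr
    exact ((hJ n).norm_le (hl n) _).trans (h1 (sub hr))
  · filter_upwards [ae_timeMeasure_iff.1 h.equation, ae_timeMeasure_iff.1 h.ae_eq] with r h1 h2 hr
    have t1 := ((tendsto_const_nhds (x := u r • χ - convection (y r))).inner (𝕜 := ℝ)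
      (tendsto_toH_resolvent hl hJ h0 (y r))).sub
      ((tendsto_inner_dx_resolvent hl hJ h0 (y r)).const_mul ν)
    rw [inner_sub_left, inner_convection_self, real_inner_smul_left, sub_zero] at t1
    refine t1.congr fun n => ?_
    rw [h2 (sub hr), h1 (sub hr)]

theorem exists_resolvents : ∃ (l : ℕ → ℝ) (J : ℕ → H →L[ℝ] V), (∀ n, 0 < l n) ∧
    (∀ n, IsResolvent (l n) (J n)) ∧ Filter.Tendsto l Filter.atTop (nhds 0) := by
  choose J hJ using fun n : ℕ => exists_isResolvent (l := 1 / ((n : ℝ) + 1)) (by positivity)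
  exact ⟨_, J, fun n => by positivity, hJ, tendsto_one_div_add_atTop_nhds_zero_nat⟩

theorem inner_resolvent_sub (hT : 0 < T) (h : IsBurgersSolution ν T χ u y0 y dy z)
    {B : H →L[ℝ] V} (hB : ∀ f g, inner ℝ f (toH (B g)) = inner ℝ (toH (B f)) g)
    {t : ℝ} (ht : t ∈ Icc 0 T) :
    inner ℝ (z t) (toH (B (z t))) = inner ℝ (toH y0) (toH (B (toH y0)))
      + 2 * ∫ r in (0)..t, dy r (B (z r)) := by
  have := inner_sub_inner_eq_integral hT.le h.continuousOn
    ((integrable_timeMeasure_iff hT.le).1 (h.memLp_deriv.integrable (by norm_num))) h.sub_eq hB ht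
  rw [h.initial] at this
  linarith

theorem energy_eq (hT : 0 < T) (h : IsBurgersSolution ν T χ u y0 y dy z) :
    ∀ᵐ t ∂timeMeasure T, ‖toH (y t)‖ ^ 2 = ‖toH y0‖ ^ 2
      + 2 * ∫ r in (0)..t, (u r * inner ℝ χ (toH (y r)) - ν * ‖dx (y r)‖ ^ 2) := by
  obtain ⟨l, J, hl, hJ, h0⟩ := exists_resolvents
  have hm : ∀ᵐ t ∂timeMeasure T, t ∈ Ioo 0 T := ae_restrict_mem measurableSet_Ioo
  filter_upwards [h.ae_eq, hm] with t ht htm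
  have htI := Ioo_subset_Icc_self htm
  have e : ∀ n, inner ℝ (toH (y t)) (toH (J n (toH (y t)))) = inner ℝ (toH y0) (toH (J n (toH y0)))
      + 2 * ∫ r in (0)..t, dy r (J n (z r)) := by
    intro n
    rw [← ht]
    exact h.inner_resolvent_sub hT (fun f g => ((hJ n).inner_symm f g).symm) htI
  have l1 := (tendsto_const_nhds (x := toH (y t))).inner (𝕜 := ℝ)
    (tendsto_toH_resolvent hl hJ h0 (y t))
  have l2 := ((tendsto_const_nhds (x := toH y0)).inner (𝕜 := ℝ)
    (tendsto_toH_resolvent hl hJ h0 y0)).add ((h.tendsto_energy hT hl hJ h0 htI).const_mul 2)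
  rw [real_inner_self_eq_norm_sq] at l1 l2
  exact tendsto_nhds_unique l1 (l2.congr fun n => (e n).symm)

/-- The energy identity holds only at almost every time, and `z T` is known only to lie in `H`. At
the end point the sign of `⟪z T, J (z T)⟫` is enough to bound the whole dissipation. -/
theorem energy_nonneg (hT : 0 < T) (h : IsBurgersSolution ν T χ u y0 y dy z) :
    0 ≤ ‖toH y0‖ ^ 2
      + 2 * ∫ r in (0)..T, (u r * inner ℝ χ (toH (y r)) - ν * ‖dx (y r)‖ ^ 2) := by
  obtain ⟨l, J, hl, hJ, h0⟩ := exists_resolvents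
  have htI : T ∈ Icc 0 T := ⟨hT.le, le_rfl⟩
  have l2 := ((tendsto_const_nhds (x := toH y0)).inner (𝕜 := ℝ)
    (tendsto_toH_resolvent hl hJ h0 y0)).add ((h.tendsto_energy hT hl hJ h0 htI).const_mul 2)
  rw [real_inner_self_eq_norm_sq] at l2
  refine ge_of_tendsto l2 (Filter.Eventually.of_forall fun n => ?_)
  rw [← h.inner_resolvent_sub hT (fun f g => ((hJ n).inner_symm f g).symm) htI,
    ← (hJ n).norm_sq_add]
  have := hl n
  positivity

theorem norm_toH_sq_le (hT : 0 < T) (hν : 0 ≤ ν) (h : IsBurgersSolution ν T χ u y0 y dy z) :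
    ∀ᵐ t ∂timeMeasure T, ‖toH (y t)‖ ^ 2
      ≤ (‖toH y0‖ ^ 2 + ‖χ‖ ^ 2 * ∫ r in (0)..T, u r ^ 2) * Real.exp T := by
  have iu := (integrable_timeMeasure_iff hT.le).1 h.integrable_control_sq
  have iy := (integrable_timeMeasure_iff hT.le).1 h.integrable_norm_sq_toH
  have iuy := (integrable_timeMeasure_iff hT.le).1 h.integrable_control_mul
  have idx := (integrable_timeMeasure_iff hT.le).1 h.integrable_norm_sq_dx
  have hU : 0 ≤ ∫ r in (0)..T, u r ^ 2 :=
    intervalIntegral.integral_nonneg hT.le fun _ _ => sq_nonneg _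
  have := gronwall_integral (β := fun _ => 1) (X := fun t => ‖toH (y t)‖ ^ 2) (T := T)
    (K := ‖toH y0‖ ^ 2 + ‖χ‖ ^ 2 * ∫ r in (0)..T, u r ^ 2) hT.le (by positivity)
    (fun _ => zero_le_one) (fun _ => sq_nonneg _) (by simp) (by simpa using iy) ?_
  · rw [ae_timeMeasure_iff]
    simpa using this
  · filter_upwards [ae_timeMeasure_iff.1 (h.energy_eq hT)] with t ht htm
    rw [ht htm]
    have hst := uIcc_subset_of_mem le_rfl htm.1.le htm.2
    have h1 : ∫ r in (0)..t, 2 * (u r * inner ℝ χ (toH (y r)) - ν * ‖dx (y r)‖ ^ 2)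
        ≤ ∫ r in (0)..t, (‖χ‖ ^ 2 * u r ^ 2 + 1 * ‖toH (y r)‖ ^ 2) := by
      refine intervalIntegral.integral_mono_on htm.1.le ?_ ?_ fun r _ => ?_
      · exact (((iuy.sub (idx.const_mul ν)).const_mul 2).mono_set hst)
      · exact (((iu.const_mul _).add (iy.const_mul 1)).mono_set hst)
      · have := control_mul_le (χ := χ) (u r) (y r)
        have h2 : 0 ≤ ν * ‖dx (y r)‖ ^ 2 := by positivity
        linarith
    rw [intervalIntegral.integral_const_mul, intervalIntegral.integral_add
      ((iu.const_mul _).mono_set hst) ((iy.const_mul 1).mono_set hst),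
      intervalIntegral.integral_const_mul] at h1
    have h2 : ∫ r in (0)..t, u r ^ 2 ≤ ∫ r in (0)..T, u r ^ 2 :=
      intervalIntegral.integral_mono_interval le_rfl htm.1.le htm.2
        (Filter.Eventually.of_forall fun r => sq_nonneg _) iu
    have h3 := mul_le_mul_of_nonneg_left h2 (sq_nonneg ‖χ‖)
    linarith

theorem integral_norm_dx_sq_le (hT : 0 < T) (h : IsBurgersSolution ν T χ u y0 y dy z) :
    2 * ν * ∫ r in (0)..T, ‖dx (y r)‖ ^ 2 ≤ ‖toH y0‖ ^ 2 + ‖χ‖ ^ 2 * (∫ r in (0)..T, u r ^ 2)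
      + ∫ r in (0)..T, ‖toH (y r)‖ ^ 2 := by
  have iu := (integrable_timeMeasure_iff hT.le).1 h.integrable_control_sq
  have iy := (integrable_timeMeasure_iff hT.le).1 h.integrable_norm_sq_toH
  have iuy := (integrable_timeMeasure_iff hT.le).1 h.integrable_control_mul
  have idx := (integrable_timeMeasure_iff hT.le).1 h.integrable_norm_sq_dx
  have h0 := h.energy_nonneg hT
  rw [intervalIntegral.integral_sub iuy (idx.const_mul ν), intervalIntegral.integral_const_mul] at h0
  have h1 : ∫ r in (0)..T, 2 * (u r * inner ℝ χ (toH (y r)))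
      ≤ ∫ r in (0)..T, (‖χ‖ ^ 2 * u r ^ 2 + ‖toH (y r)‖ ^ 2) :=
    intervalIntegral.integral_mono_on hT.le (iuy.const_mul 2) ((iu.const_mul _).add iy)
      fun r _ => control_mul_le _ _
  rw [intervalIntegral.integral_const_mul, intervalIntegral.integral_add
      (iu.const_mul _) iy, intervalIntegral.integral_const_mul] at h1
  linarith

/-- The regularized test with `-∂ₓ²y`: the form `⟪z, J A z⟫ = ‖∂ₓ J z‖²` has derivative `2 dy (J A
z)`, in which viscosity contributes exactly `-2ν ‖A y‖²`. This absorbs the forcing `u χ - y ∂ₓy`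
uniformly in `l`. -/
theorem norm_dx_sq_le_integral (hT : 0 < T) (hν : 0 < ν)
    (h : IsBurgersSolution ν T χ u y0 y dy z) :
    ∀ᵐ t ∂timeMeasure T, ‖dx (y t)‖ ^ 2
      ≤ (‖dx y0‖ ^ 2 + ‖χ‖ ^ 2 / ν * ∫ r in (0)..T, u r ^ 2)
        + ∫ r in (0)..t, 2 / ν * ‖y r‖ ^ 2 * ‖dx (y r)‖ ^ 2 := by
  obtain ⟨l, J, hl, hJ, h0⟩ := exists_resolvents
  have hm : ∀ᵐ t ∂timeMeasure T, t ∈ Ioo 0 T := ae_restrict_mem measurableSet_Ioo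
  have iu := (integrable_timeMeasure_iff hT.le).1 h.integrable_control_sq
  have iyd := (integrable_timeMeasure_iff hT.le).1 h.integrable_mul_sq_dx
  have hdy : IntervalIntegrable dy volume 0 T :=
    (integrable_timeMeasure_iff hT.le).1 (h.memLp_deriv.integrable (by norm_num))
  filter_upwards [h.ae_eq, hm] with t ht htm
  have htI := Ioo_subset_Icc_self htm
  have hst := uIcc_subset_of_mem le_rfl htI.1 htI.2
  refine norm_dx_le_of_forall_resolvent hl hJ h0 (y t) fun n => ?_
  set A := yosida (l n) (J n) with hA
  have hsymm : ∀ f g, inner ℝ f (toH ((J n ∘L A) g)) = inner ℝ (toH ((J n ∘L A) f)) g := by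
    intro f g
    simp only [ContinuousLinearMap.comp_apply]
    rw [hA, (hJ n).inner_comp_yosida (hl n), real_inner_comm g, (hJ n).inner_comp_yosida (hl n),
      real_inner_comm]
  have e := h.inner_resolvent_sub hT hsymm htI
  simp only [ContinuousLinearMap.comp_apply] at e
  rw [hA, (hJ n).inner_comp_yosida (hl n), (hJ n).inner_comp_yosida (hl n),
    real_inner_self_eq_norm_sq, real_inner_self_eq_norm_sq, ← hA, ht] at e
  rw [e]
  have hp := (intervalIntegrable_dual_apply hT.le h.continuousOn hdy (J n ∘L A)).mono_set hst
  have h1 : ∫ r in (0)..t, 2 * dy r (J n (A (z r)))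
      ≤ ∫ r in (0)..t, (‖χ‖ ^ 2 / ν * u r ^ 2 + 2 / ν * (‖y r‖ ^ 2 * ‖dx (y r)‖ ^ 2)) := by
    refine intervalIntegral.integral_mono_ae_restrict htI.1 (hp.const_mul 2)
      (((iu.const_mul _).add (iyd.const_mul _)).mono_set hst) ?_
    have hsub : Icc 0 t ⊆ Icc 0 T := Icc_subset_Icc le_rfl htI.2
    have hae : ∀ᵐ r ∂timeMeasure T, 2 * dy r (J n (A (z r)))
        ≤ ‖χ‖ ^ 2 / ν * u r ^ 2 + 2 / ν * (‖y r‖ ^ 2 * ‖dx (y r)‖ ^ 2) := by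
      filter_upwards [h.ae_eq, h.equation] with r hr1 hr2
      rw [hr1, hr2, hA, (hJ n).inner_dx_comp_yosida (hl n), ← hA]
      have b1 := real_inner_le_norm (u r • χ - convection (y r)) (toH (J n (A (toH (y r)))))
      have b2 := (hJ n).norm_toH_le (hl n) (A (toH (y r)))
      have b3 := norm_forcing_sq_le (χ := χ) (u r) (y r)
      set F := ‖u r • χ - convection (y r)‖ with hF
      set a := ‖A (toH (y r))‖ with ha
      have b4 : F * ‖toH (J n (A (toH (y r))))‖ ≤ F * a := by gcongr
      -- Young's inequality with the full viscous term, that is `(F - 2νa)² ≥ 0`.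
      have b5 : 2 * (F * a - ν * a ^ 2) ≤ F ^ 2 / (2 * ν) := by
        rw [le_div_iff₀ (by positivity)]
        nlinarith [sq_nonneg (F - 2 * ν * a)]
      have b6 : F ^ 2 / (2 * ν) ≤ (2 * ‖χ‖ ^ 2 * u r ^ 2 + 4 * (‖y r‖ ^ 2 * ‖dx (y r)‖ ^ 2)) / (2 * ν) := by
        gcongr
      have b7 : (2 * ‖χ‖ ^ 2 * u r ^ 2 + 4 * (‖y r‖ ^ 2 * ‖dx (y r)‖ ^ 2)) / (2 * ν)
          = ‖χ‖ ^ 2 / ν * u r ^ 2 + 2 / ν * (‖y r‖ ^ 2 * ‖dx (y r)‖ ^ 2) := by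
        field_simp; ring
      linarith
    rw [timeMeasure_eq_Icc] at hae
    exact ae_restrict_of_ae_restrict_of_subset hsub hae
  rw [intervalIntegral.integral_const_mul, intervalIntegral.integral_add
      ((iu.const_mul _).mono_set hst) ((iyd.const_mul _).mono_set hst),
      intervalIntegral.integral_const_mul] at h1
  have h2 : ∫ r in (0)..t, u r ^ 2 ≤ ∫ r in (0)..T, u r ^ 2 :=
    intervalIntegral.integral_mono_interval le_rfl htm.1.le htI.2
      (Filter.Eventually.of_forall fun r => sq_nonneg _) iu
  have h3 : ‖χ‖ ^ 2 / ν * (∫ r in (0)..t, u r ^ 2) ≤ ‖χ‖ ^ 2 / ν * ∫ r in (0)..T, u r ^ 2 := by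
    gcongr
  have h4 : ‖dx (J n (toH y0))‖ ^ 2 ≤ ‖dx y0‖ ^ 2 := by
    have := (hJ n).norm_dx_le (hl n) y0
    gcongr
  simp only [mul_assoc] at h1 h3 ⊢
  linarith

/-- The quartic term is read as linear in `‖∂ₓy‖²` with weight `2/ν ‖y‖²`, whose integral the first
energy estimate controls. -/
theorem norm_dx_sq_le (hT : 0 < T) (hν : 0 < ν) (h : IsBurgersSolution ν T χ u y0 y dy z) :
    ∀ᵐ t ∂timeMeasure T, ‖dx (y t)‖ ^ 2
      ≤ (‖dx y0‖ ^ 2 + ‖χ‖ ^ 2 / ν * ∫ r in (0)..T, u r ^ 2)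
        * Real.exp (2 / ν * ∫ r in (0)..T, ‖y r‖ ^ 2) := by
  have iy := (integrable_timeMeasure_iff hT.le).1 h.integrable_norm_sq
  have iyd := (integrable_timeMeasure_iff hT.le).1 h.integrable_mul_sq_dx
  have hU : 0 ≤ ∫ r in (0)..T, u r ^ 2 :=
    intervalIntegral.integral_nonneg hT.le fun _ _ => sq_nonneg _
  rw [ae_timeMeasure_iff, ← intervalIntegral.integral_const_mul (2 / ν)]
  refine gronwall_integral (β := fun t => 2 / ν * ‖y t‖ ^ 2) (X := fun t => ‖dx (y t)‖ ^ 2) hT.le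
    (by positivity) (fun _ => by positivity) (fun _ => sq_nonneg _) (iy.const_mul _) ?_
    (ae_timeMeasure_iff.1 (h.norm_dx_sq_le_integral hT hν))
  simpa only [mul_assoc] using iyd.const_mul (2 / ν)

theorem norm_deriv_sq_le (hν : 0 ≤ ν) (h : IsBurgersSolution ν T χ u y0 y dy z) :
    ∀ᵐ t ∂timeMeasure T, ‖dy t‖ ^ 2 ≤ 4 * ‖χ‖ ^ 2 * u t ^ 2 + 8 * (‖y t‖ ^ 2 * ‖dx (y t)‖ ^ 2)
      + 2 * ν ^ 2 * ‖dx (y t)‖ ^ 2 := by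
  filter_upwards [h.equation] with t ht
  have b3 := norm_forcing_sq_le (χ := χ) (u t) (y t)
  set F := ‖u t • χ - convection (y t)‖ with hF
  have b : ‖dy t‖ ≤ F + ν * ‖dx (y t)‖ := by
    refine (dy t).opNorm_le_bound (by positivity) fun φ => ?_
    rw [ht φ, Real.norm_eq_abs]
    have h1 := abs_real_inner_le_norm (u t • χ - convection (y t)) (toH φ)
    have h2 := abs_real_inner_le_norm (dx (y t)) (dx φ)
    have h3 : F * ‖toH φ‖ ≤ F * ‖φ‖ := by gcongr; exact norm_toH_le φ
    have h4 : ‖dx (y t)‖ * ‖dx φ‖ ≤ ‖dx (y t)‖ * ‖φ‖ := by gcongr; exact norm_dx_le φ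
    have h5 : ν * |inner ℝ (dx (y t)) (dx φ)| ≤ ν * (‖dx (y t)‖ * ‖φ‖) := by
      gcongr; exact h2.trans h4
    refine (abs_sub _ _).trans ?_
    rw [abs_mul, abs_of_nonneg hν]
    linarith
  have : ‖dy t‖ ^ 2 ≤ (F + ν * ‖dx (y t)‖) ^ 2 := by gcongr
  nlinarith [sq_nonneg (F - ν * ‖dx (y t)‖)]

end IsBurgersSolution

/-! ### The state bound with explicit constants -/

set_option maxHeartbeats 1000000 in
-- The second bound is what the particle positions need: the integral is quadratic in the data and
-- is still placed below the same constant, with factor one.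
theorem exists_state_bound {ν T : ℝ} (hT : 0 < T) (hν : 0 < ν) (χ : H) :
    ∃ C : ℝ, 0 < C ∧ ∀ (u : ℝ → ℝ) (y0 : V) (y : ℝ → V) (dy : ℝ → VDual) (z : ℝ → H),
      IsBurgersSolution ν T χ u y0 y dy z →
        normLinf T y + normW T y dy ≤ Cstate C T u y0 ∧
          ∫ r in (0)..T, ‖y r‖ ^ 2 ≤ Cstate C T u y0 := by
  -- `k1` bounds `‖y‖_H²`, `k2` twice `ν` times the dissipation and `k3` the integral of `‖y‖_V²`,
  -- each as a multiple of `S`. `k4` is the Gronwall exponent; `k5` and `k6` are the prefactors for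
  -- the squared `L^∞(V)` and `W(V)` norms.
  obtain ⟨k1, hk1⟩ : ∃ k : ℝ, k = (1 + ‖χ‖ ^ 2) * Real.exp T := ⟨_, rfl⟩
  obtain ⟨k2, hk2⟩ : ∃ k : ℝ, k = 1 + ‖χ‖ ^ 2 + T * k1 := ⟨_, rfl⟩
  obtain ⟨k3, hk3⟩ : ∃ k : ℝ, k = T * k1 + k2 / (2 * ν) := ⟨_, rfl⟩
  obtain ⟨k4, hk4⟩ : ∃ k : ℝ, k = 2 / ν * k3 := ⟨_, rfl⟩
  obtain ⟨k5, hk5⟩ : ∃ k : ℝ, k = k1 + 1 + ‖χ‖ ^ 2 / ν := ⟨_, rfl⟩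
  obtain ⟨k6, hk6⟩ : ∃ k : ℝ, k = k3 + 4 * ‖χ‖ ^ 2 + 8 * (k5 * k3) + 2 * ν ^ 2 * k3 := ⟨_, rfl⟩
  have p1 : 0 < k1 := by rw [hk1]; positivity
  have p2 : 0 < k2 := by rw [hk2]; positivity
  have p3 : 0 < k3 := by rw [hk3]; positivity
  have p4 : 0 < k4 := by rw [hk4]; positivity
  have p5 : 0 < k5 := by rw [hk5]; positivity
  have p6 : 0 < k6 := by rw [hk6]; positivity
  obtain ⟨C, hC⟩ : ∃ C : ℝ, C = √k5 + √k6 + (k4 + 1) + k3 := ⟨_, rfl⟩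
  have pC : 0 < C := by rw [hC]; positivity
  refine ⟨C, pC, fun u y0 y dy z h => ?_⟩
  have iu := (integrable_timeMeasure_iff hT.le).1 h.integrable_control_sq
  have iyH := (integrable_timeMeasure_iff hT.le).1 h.integrable_norm_sq_toH
  have iyV := (integrable_timeMeasure_iff hT.le).1 h.integrable_norm_sq
  have idx := (integrable_timeMeasure_iff hT.le).1 h.integrable_norm_sq_dx
  have iyd := (integrable_timeMeasure_iff hT.le).1 h.integrable_mul_sq_dx
  have idy := (integrable_timeMeasure_iff hT.le).1 (h.memLp_deriv.integrable_norm_pow two_ne_zero)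
  have hU : normL2 T u ^ 2 = ∫ r in (0)..T, u r ^ 2 := by
    rw [normL2_sq h.memLp_control, integral_timeMeasure hT.le]
    simp
  set n := normL2 T u with hn
  have hn0 : 0 ≤ n := ENNReal.toReal_nonneg
  set S := n ^ 2 + ‖toH y0‖ ^ 2 with hS
  set D := n + ‖y0‖ with hD
  have hCs : Cstate C T u y0 = C * D * Real.exp (C * S) := rfl
  rw [hCs]
  clear_value D S n
  have hS0 : 0 ≤ S := by rw [hS]; positivity
  have hD0 : 0 ≤ D := by rw [hD]; positivity
  have hnV : n ^ 2 + ‖y0‖ ^ 2 ≤ D ^ 2 := by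
    have : 0 ≤ n * ‖y0‖ := by positivity
    rw [hD]; nlinarith
  have hSD : S ≤ D ^ 2 := by
    have := norm_sq_V y0
    have := sq_nonneg ‖dx y0‖
    linarith
  have hSe : S ≤ Real.exp S := by linarith [Real.add_one_le_exp S]
  -- Trades one of the two factors `√S` for an exponential, since `Cstate` is only linear in `D`.
  have hSDe : S ≤ D * Real.exp S := by
    have h1 : √S ≤ D := Real.sqrt_le_left hD0 |>.2 hSD
    have h2 : √S ≤ Real.exp S := by
      have : √S ≤ 1 + S := Real.sqrt_le_left (by positivity) |>.2 (by nlinarith)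
      linarith [Real.add_one_le_exp S]
    calc S = √S * √S := (Real.mul_self_sqrt hS0).symm
      _ ≤ D * Real.exp S := by gcongr
  have hK1 : ‖toH y0‖ ^ 2 + ‖χ‖ ^ 2 * (∫ r in (0)..T, u r ^ 2) ≤ (1 + ‖χ‖ ^ 2) * S := by
    rw [← hU, hS]
    have : 0 ≤ ‖χ‖ ^ 2 * ‖toH y0‖ ^ 2 := by positivity
    nlinarith [sq_nonneg n]
  have r1 : ∀ᵐ t ∂timeMeasure T, ‖toH (y t)‖ ^ 2 ≤ k1 * S := by
    filter_upwards [h.norm_toH_sq_le hT hν.le] with t ht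
    calc _ ≤ _ := ht
      _ ≤ (1 + ‖χ‖ ^ 2) * S * Real.exp T := by gcongr
      _ = k1 * S := by rw [hk1]; ring
  have mono_ae : ∀ {f g : ℝ → ℝ}, IntervalIntegrable f volume 0 T →
      IntervalIntegrable g volume 0 T → (∀ᵐ t ∂timeMeasure T, f t ≤ g t) →
      ∫ t in (0)..T, f t ≤ ∫ t in (0)..T, g t := by
    intro f g hf hg hfg
    rw [timeMeasure_eq_Icc] at hfg
    exact intervalIntegral.integral_mono_ae_restrict hT.le hf hg hfg
  have r1i : ∫ r in (0)..T, ‖toH (y r)‖ ^ 2 ≤ T * k1 * S := by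
    refine (mono_ae iyH intervalIntegrable_const r1).trans ?_
    rw [intervalIntegral.integral_const, smul_eq_mul, sub_zero, ← mul_assoc]
  have r2 : ∫ r in (0)..T, ‖dx (y r)‖ ^ 2 ≤ k2 / (2 * ν) * S := by
    have := h.integral_norm_dx_sq_le hT
    rw [div_mul_eq_mul_div, le_div_iff₀ (by positivity)]
    rw [hk2]
    linarith
  have r3 : ∫ r in (0)..T, ‖y r‖ ^ 2 ≤ k3 * S := by
    simp only [norm_sq_V]
    rw [intervalIntegral.integral_add iyH idx, hk3]
    linarith
  have r4 : ∀ᵐ t ∂timeMeasure T, ‖dx (y t)‖ ^ 2 ≤ (1 + ‖χ‖ ^ 2 / ν) * D ^ 2 * Real.exp (k4 * S) := by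
    filter_upwards [h.norm_dx_sq_le hT hν] with t ht
    refine ht.trans ?_
    have a1 : ‖dx y0‖ ^ 2 + ‖χ‖ ^ 2 / ν * (∫ r in (0)..T, u r ^ 2)
        ≤ (1 + ‖χ‖ ^ 2 / ν) * D ^ 2 := by
      rw [← hU]
      have b1 := norm_sq_V y0
      have b2 := sq_nonneg ‖toH y0‖
      have b3 : 0 ≤ ‖χ‖ ^ 2 / ν := by positivity
      have b4 : n ^ 2 ≤ D ^ 2 := by linarith [sq_nonneg ‖y0‖]
      have b5 : ‖χ‖ ^ 2 / ν * n ^ 2 ≤ ‖χ‖ ^ 2 / ν * D ^ 2 := by gcongr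
      linarith [sq_nonneg n]
    have a2 : 2 / ν * (∫ r in (0)..T, ‖y r‖ ^ 2) ≤ k4 * S := by
      rw [hk4, mul_assoc]
      gcongr
    gcongr
  have he1 : 1 ≤ Real.exp (k4 * S) := Real.one_le_exp (by positivity)
  have r5 : ∀ᵐ t ∂timeMeasure T, ‖y t‖ ^ 2 ≤ k5 * D ^ 2 * Real.exp (k4 * S) := by
    filter_upwards [r1, r4] with t h1 h2
    rw [norm_sq_V]
    have : k1 * S ≤ k1 * D ^ 2 * Real.exp (k4 * S) := by
      calc k1 * S ≤ k1 * D ^ 2 * 1 := by rw [mul_one]; gcongr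
        _ ≤ _ := by gcongr
    rw [hk5]
    linarith
  have expsq : ∀ k : ℝ, Real.exp (k * S) = Real.exp (k / 2 * S) ^ 2 := by
    intro k
    rw [← Real.exp_nat_mul]
    congr 1
    push_cast
    ring
  have nl : normLinf T y ≤ √k5 * D * Real.exp (k4 / 2 * S) := by
    refine normLinf_le (by positivity) ?_
    filter_upwards [r5] with t ht
    refine (pow_le_pow_iff_left₀ (norm_nonneg _) (by positivity) two_ne_zero).1 ?_
    rw [mul_pow, mul_pow, Real.sq_sqrt p5.le, ← expsq]
    exact ht
  -- The extra `1` in the exponent comes from `S ≤ exp S`, applied to the integral of `‖y‖²` in the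
  -- convection term.
  have rd : normL2 T dy ^ 2
      ≤ (4 * ‖χ‖ ^ 2 + 8 * (k5 * k3) + 2 * ν ^ 2 * k3) * D ^ 2 * Real.exp ((k4 + 1) * S) := by
    have hint : ∫ t in (0)..T, ‖y t‖ ^ 2 * ‖dx (y t)‖ ^ 2
        ≤ k5 * k3 * D ^ 2 * Real.exp ((k4 + 1) * S) := by
      calc ∫ t in (0)..T, ‖y t‖ ^ 2 * ‖dx (y t)‖ ^ 2
          ≤ ∫ t in (0)..T, k5 * D ^ 2 * Real.exp (k4 * S) * ‖y t‖ ^ 2 := by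
            refine mono_ae iyd (iyV.const_mul _) ?_
            filter_upwards [r5] with t ht
            have := norm_dx_le (y t)
            have h2 : ‖dx (y t)‖ ^ 2 ≤ ‖y t‖ ^ 2 := by gcongr
            exact mul_le_mul ht h2 (sq_nonneg _) (by positivity)
        _ = k5 * D ^ 2 * Real.exp (k4 * S) * ∫ t in (0)..T, ‖y t‖ ^ 2 :=
            intervalIntegral.integral_const_mul _ _
        _ ≤ k5 * D ^ 2 * Real.exp (k4 * S) * (k3 * Real.exp S) := by
            gcongr
            exact r3.trans (by gcongr)
        _ = k5 * k3 * D ^ 2 * Real.exp ((k4 + 1) * S) := by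
            rw [add_mul, one_mul, Real.exp_add]; ring
    have hX : (1 : ℝ) ≤ Real.exp ((k4 + 1) * S) := Real.one_le_exp (by positivity)
    have hdx : ∫ t in (0)..T, ‖dx (y t)‖ ^ 2 ≤ k3 * D ^ 2 * Real.exp ((k4 + 1) * S) := by
      have : k2 / (2 * ν) * S ≤ k3 * D ^ 2 := by
        have : k2 / (2 * ν) ≤ k3 := by
          have : 0 ≤ T * k1 := by positivity
          rw [hk3]
          linarith
        gcongr
      calc _ ≤ k3 * D ^ 2 * 1 := by linarith
        _ ≤ _ := by gcongr
    have hn2 : n ^ 2 ≤ D ^ 2 * Real.exp ((k4 + 1) * S) := by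
      calc n ^ 2 ≤ D ^ 2 * 1 := by linarith [sq_nonneg ‖y0‖]
        _ ≤ _ := by gcongr
    rw [normL2_sq h.memLp_deriv, integral_timeMeasure hT.le]
    have := mono_ae idy (((iu.const_mul (4 * ‖χ‖ ^ 2)).add (iyd.const_mul 8)).add
      (idx.const_mul (2 * ν ^ 2))) (h.norm_deriv_sq_le hν.le)
    rw [intervalIntegral.integral_add ((iu.const_mul _).add (iyd.const_mul 8))
      (idx.const_mul _), intervalIntegral.integral_add (iu.const_mul _) (iyd.const_mul 8),
      intervalIntegral.integral_const_mul, intervalIntegral.integral_const_mul,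
      intervalIntegral.integral_const_mul, ← hU] at this
    have t1 : 4 * ‖χ‖ ^ 2 * n ^ 2 ≤ 4 * ‖χ‖ ^ 2 * (D ^ 2 * Real.exp ((k4 + 1) * S)) := by gcongr
    have t2 : 2 * ν ^ 2 * (∫ t in (0)..T, ‖dx (y t)‖ ^ 2)
        ≤ 2 * ν ^ 2 * (k3 * D ^ 2 * Real.exp ((k4 + 1) * S)) := by gcongr
    linarith
  have nw : normW T y dy ≤ √k6 * D * Real.exp ((k4 + 1) / 2 * S) := by
    rw [normW]
    refine Real.sqrt_le_left (by positivity) |>.2 ?_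
    rw [mul_pow, mul_pow, Real.sq_sqrt p6.le, ← expsq, normL2_sq h.memLp,
      integral_timeMeasure hT.le]
    have hX : (1 : ℝ) ≤ Real.exp ((k4 + 1) * S) := Real.one_le_exp (by positivity)
    have : k3 * S ≤ k3 * D ^ 2 * Real.exp ((k4 + 1) * S) := by
      calc k3 * S ≤ k3 * D ^ 2 * 1 := by rw [mul_one]; gcongr
        _ ≤ _ := by gcongr
    rw [hk6]
    linarith
  have c1 : k4 + 1 ≤ C := by
    rw [hC]; linarith [Real.sqrt_nonneg k5, Real.sqrt_nonneg k6]
  have c2 : √k5 + √k6 ≤ C := by rw [hC]; linarith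
  have c3 : k3 ≤ C := by
    rw [hC]; linarith [Real.sqrt_nonneg k5, Real.sqrt_nonneg k6]
  have hexp : ∀ k : ℝ, k ≤ C → Real.exp (k * S) ≤ Real.exp (C * S) := fun k hk => by gcongr
  constructor
  · calc normLinf T y + normW T y dy
        ≤ √k5 * D * Real.exp (k4 / 2 * S) + √k6 * D * Real.exp ((k4 + 1) / 2 * S) :=
          add_le_add nl nw
      _ ≤ √k5 * D * Real.exp (C * S) + √k6 * D * Real.exp (C * S) := by
          have a1 := hexp (k4 / 2) (by linarith)
          have a2 := hexp ((k4 + 1) / 2) (by linarith)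
          gcongr
      _ = (√k5 + √k6) * D * Real.exp (C * S) := by ring
      _ ≤ C * D * Real.exp (C * S) := by gcongr
  · calc _ ≤ k3 * S := r3
      _ ≤ k3 * (D * Real.exp S) := by gcongr
      _ ≤ C * (D * Real.exp (C * S)) := by
          have := hexp 1 (by linarith)
          rw [one_mul] at this
          gcongr
      _ = C * D * Real.exp (C * S) := by ring

/-! ### Particle positions -/

theorem continuous_particleSum {ζ : ℝ → ℝ} (hζ : Continuous ζ) (ε : ℝ) {N : ℕ}
    (α Φ : Fin N → ℝ → ℝ) (t : ℝ) : Continuous (particleSum ζ ε α Φ t) := by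
  unfold particleSum deltaEps
  fun_prop

theorem abs_le_of_ae_abs_le {f : ℝ → ℝ} (hf : Continuous f) {M : ℝ} (h : ∀ᵐ x, |f x| ≤ M)
    (x : ℝ) : |f x| ≤ M := by
  have h1 : (fun x => max |f x| M) =ᵐ[volume] fun _ => M := by
    filter_upwards [h] with x hx using max_eq_right hx
  have h2 := (Continuous.ae_eq_iff_eq volume (by fun_prop) continuous_const).1 h1
  exact max_eq_right_iff.1 (congrFun h2 x)

/-- The Sobolev bound holds for almost every `x`, while the velocity is a point value. The particle
sum is a continuous representative, so the bound holds at every point, in particular at `Φᵢ(t)`. -/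
theorem IsParticleSolution.ae_velocity_sq_le {ν T : ℝ} {χ u : ℝ → ℝ} {y0 : V}
    {ζ : ℝ → ℝ} {ε : ℝ} {N : ℕ} {y : ℝ → V} {dy : ℝ → VDual} {Φ dΦ : Fin N → ℝ → ℝ}
    (h : IsParticleSolution ν T χ u y0 ζ ε y dy Φ dΦ) (hζ : Continuous ζ) (i : Fin N) :
    ∀ᵐ t ∂timeMeasure T, dΦ i t ^ 2 ≤ 2 * ‖y t‖ ^ 2 := by
  obtain ⟨α, h1, h2⟩ := h.particle
  filter_upwards [h1, h2 i] with t ht1 ht2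
  have hb : |dΦ i t| ≤ √2 * ‖y t‖ := by
    rw [ht2]
    refine abs_le_of_ae_abs_le (continuous_particleSum hζ ε α Φ t) ?_ _
    filter_upwards [ht1, ae_abs_toH_le (y t)] with x hx1 hx2
    rwa [← hx1]
  calc dΦ i t ^ 2 = |dΦ i t| ^ 2 := (sq_abs _).symm
    _ ≤ (√2 * ‖y t‖) ^ 2 := by gcongr
    _ = 2 * ‖y t‖ ^ 2 := by rw [mul_pow, Real.sq_sqrt (by norm_num)]

theorem MemH1Time.integral_sq_le {T : ℝ} (hT : 0 < T) {f df : ℝ → ℝ} (h : MemH1Time T f df)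
    (hc : ContinuousOn f (Icc 0 T)) :
    ∫ t, f t * f t ∂timeMeasure T
      ≤ T * (2 * f 0 ^ 2 + 2 * T * ∫ t, df t * df t ∂timeMeasure T) := by
  have if2 := (integrable_timeMeasure_iff hT.le).1 h.memLp.integrable_sq
  have idf := (integrable_timeMeasure_iff hT.le).1 (h.memLp_deriv.integrable (by norm_num))
  have idf2 := (integrable_timeMeasure_iff hT.le).1 h.memLp_deriv.integrable_sq
  simp only [← sq]
  rw [integral_timeMeasure hT.le, integral_timeMeasure hT.le]
  have pt : ∀ t ∈ Icc 0 T, f t ^ 2 ≤ 2 * f 0 ^ 2 + 2 * T * ∫ t in (0)..T, df t ^ 2 := by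
    intro t ht
    have e := sub_eq_integral_of_isWeakDeriv hT (h.memLp.integrable (by norm_num))
      (h.memLp_deriv.integrable (by norm_num)) h.weakDeriv hc
      (Filter.Eventually.of_forall fun _ => rfl) ⟨le_rfl, hT.le⟩ ht
    have hst := uIcc_subset_of_mem le_rfl ht.1 ht.2
    have h1 := sq_integral_le ht.1 (idf.mono_set hst) (idf2.mono_set hst)
    rw [← e, sub_zero] at h1
    have h2 : ∫ r in (0)..t, df r ^ 2 ≤ ∫ r in (0)..T, df r ^ 2 :=
      intervalIntegral.integral_mono_interval le_rfl ht.1 ht.2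
        (Filter.Eventually.of_forall fun r => sq_nonneg _) idf2
    have h3 : t * (∫ r in (0)..t, df r ^ 2) ≤ T * ∫ r in (0)..T, df r ^ 2 :=
      mul_le_mul ht.2 h2 (intervalIntegral.integral_nonneg ht.1 fun _ _ => sq_nonneg _) hT.le
    -- `2 f(0)² + 2 (f(t) - f(0))² - f(t)² = (f(t) - 2 f(0))²`.
    nlinarith [sq_nonneg (f t - f 0 - f 0)]
  have := intervalIntegral.integral_mono_on hT.le if2 intervalIntegrable_const pt
  rwa [intervalIntegral.integral_const, smul_eq_mul, sub_zero] at this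

/-- The sum of the neighbour distances telescopes to the length of the interval plus the distance
between the first and the last point, hence at most twice the length. -/
theorem IsInitialGrid.sum_le {a b η : ℝ} (hab : a ≤ b) (hη : 0 < η) {N : ℕ} {X h : Fin N → ℝ}
    (hX : IsInitialGrid a b η X h) : ∑ i, h i ≤ 2 * (b - a + 2 * η) := by
  rcases N with _ | n
  · simp only [Finset.univ_eq_empty, Finset.sum_empty]
    linarith
  have h1 : ∑ i, h i ≤ ∑ i, (rightNeighbour (b + η) X i - leftNeighbour (a - η) X i) :=
    Finset.sum_le_sum fun i _ => hX.distance_le i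
  have eR : ∑ i, rightNeighbour (b + η) X i = (∑ i : Fin n, X i.succ) + (b + η) := by
    rw [Fin.sum_univ_castSucc]
    congr 1
    · refine Finset.sum_congr rfl fun i _ => ?_
      have hi : (i.castSucc : ℕ) + 1 < n + 1 := by simp
      rw [rightNeighbour, dif_pos hi]
      rfl
    · simp [rightNeighbour]
  have eL : ∑ i, leftNeighbour (a - η) X i = (a - η) + ∑ i : Fin n, X i.castSucc := by
    rw [Fin.sum_univ_succ]
    congr 1
  have e1 := Fin.sum_univ_succ X
  have e2 := Fin.sum_univ_castSucc X
  rw [Finset.sum_sub_distrib, eR, eL] at h1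
  have m1 := (hX.mem_Icc 0).1
  have m2 := (hX.mem_Icc (Fin.last n)).2
  linarith

/-- With `Y` the integral and `A` the product with `σ`, the squared norm is at most `A + A Y ≤ (Y +
A + 1)²`. Passing to the root moves `A` from a factor of `Y` to an additive constant. -/
theorem IsParticleSolution.normP_le {ν T : ℝ} (hT : 0 < T) {χ u : ℝ → ℝ} {y0 : V}
    {ζ : ℝ → ℝ} {ε : ℝ} {N : ℕ} {y : ℝ → V} {dy : ℝ → VDual} {Φ dΦ : Fin N → ℝ → ℝ}
    (hs : IsParticleSolution ν T χ u y0 ζ ε y dy Φ dΦ) (hζ : Continuous ζ)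
    {h : Fin N → ℝ} (hh : ∀ i, 0 ≤ h i) {m σ : ℝ} (hσ : ∑ i, h i ≤ σ)
    (hm : ∀ i, Φ i 0 ^ 2 ≤ m ^ 2) :
    normP T h Φ dΦ ≤ (∫ r in (0)..T, ‖y r‖ ^ 2)
      + (σ * (2 * T * m ^ 2 + 4 * T ^ 2 + 2) + 1) := by
  have hσ0 : 0 ≤ σ := (Finset.sum_nonneg fun i _ => hh i).trans hσ
  set Y := ∫ r in (0)..T, ‖y r‖ ^ 2 with hY
  have hY0 : 0 ≤ Y := intervalIntegral.integral_nonneg hT.le fun _ _ => sq_nonneg _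
  have b1 : ∀ i, ∫ t, dΦ i t * dΦ i t ∂timeMeasure T ≤ 2 * Y := by
    intro i
    rw [hY, ← integral_timeMeasure hT.le, ← integral_const_mul]
    refine integral_mono_ae ?_ ((hs.memW.memLp.integrable_norm_pow two_ne_zero).const_mul 2) ?_
    · simpa only [← sq] using (hs.memP i).memLp_deriv.integrable_sq
    · filter_upwards [hs.ae_velocity_sq_le hζ i] with t ht
      rw [← sq]
      exact ht
  have b2 : ∀ i, ∫ t, Φ i t * Φ i t ∂timeMeasure T ≤ T * (2 * m ^ 2 + 2 * T * (2 * Y)) := by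
    intro i
    refine ((hs.memP i).integral_sq_le hT (hs.continuousOn i)).trans ?_
    have := hm i
    have := b1 i
    gcongr
  have sum_le : ∀ {f : Fin N → ℝ} {c : ℝ}, 0 ≤ c → (∀ i, f i ≤ c) → ∑ i, h i * f i ≤ σ * c := by
    intro f c hc hf
    calc ∑ i, h i * f i ≤ ∑ i, h i * c :=
          Finset.sum_le_sum fun i _ => mul_le_mul_of_nonneg_left (hf i) (hh i)
      _ = (∑ i, h i) * c := (Finset.sum_mul _ _ _).symm
      _ ≤ σ * c := by gcongr
  have s1 := sum_le (by positivity) b1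
  have s2 := sum_le (by positivity) b2
  set A := σ * (2 * T * m ^ 2 + 4 * T ^ 2 + 2) with hA
  have hA0 : 0 ≤ A := by positivity
  rw [normP]
  refine Real.sqrt_le_left (by positivity) |>.2 ?_
  have e1 : σ * (2 * T * m ^ 2) ≤ A := by
    rw [hA]
    gcongr
    nlinarith [sq_nonneg T]
  have e2 : σ * (4 * T ^ 2 + 2) * Y ≤ A * Y := by
    rw [hA]
    gcongr
    have : 0 ≤ 2 * T * m ^ 2 := by positivity
    linarith
  nlinarith [mul_nonneg hA0 hY0]

end Burgers

/-! ### The main theorem -/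

theorem mainTheorem10 (T : ℝ) (hT : 0 < T) :
    ∃ Csupp : ℝ → ℝ → ℝ → ℝ, (∀ a b η, 0 < Csupp a b η) ∧
      ∀ (ν : ℝ) (χ : ℝ → ℝ), 0 < ν → ContDiff ℝ ∞ χ → HasCompactSupport χ →
        ∃ C : ℝ, 0 < C ∧
          ∀ (ul uu : ℝ) (u : ℝ → ℝ) (a b : ℝ) (y0 : Burgers.V)
            (r : ℕ) (ζ : ℝ → ℝ) (ε : ℝ) (N : ℕ)
            (y : ℝ → Burgers.V) (dy : ℝ → Burgers.VDual) (Φ dΦ : Fin N → ℝ → ℝ),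
            ul ≤ uu → Burgers.Admissible T ul uu u →
            a ≤ b → Burgers.SupportedIn y0 a b →
            Burgers.IsKernel r ζ → 0 < ε →
            Burgers.IsParticleSolution ν T χ u y0 ζ ε y dy Φ dΦ →
            Burgers.normLinf T y + Burgers.normW T y dy ≤ Burgers.Cstate C T u y0 ∧
            ∀ (η : ℝ) (h : Fin N → ℝ), 0 < η →
              Burgers.IsInitialGrid a b η (fun i => Φ i 0) h →
              Burgers.normP T h Φ dΦ ≤ Burgers.Cstate C T u y0 + Csupp a b η := by
  -- `σ (2 T m² + 4 T² + 2) + 1` with `σ` the bound for the sum of the weights and `m` the bound for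
  -- the initial positions; the absolute values make it positive for all real `a, b, η`.
  refine ⟨fun a b η => 2 * (|b - a| + 2 * |η|)
    * (2 * T * (|a| + |b| + |η|) ^ 2 + 4 * T ^ 2 + 2) + 1, fun a b η => by positivity, ?_⟩
  intro ν χ hν hχ hχc
  have hχL : MemLp χ 2 (volume : Measure ℝ) := hχ.continuous.memLp_of_hasCompactSupport hχc
  obtain ⟨C, hC, hbound⟩ := Burgers.exists_state_bound hT hν (hχL.toLp χ)
  refine ⟨C, hC, ?_⟩
  intro ul uu u a b y0 r ζ ε N y dy Φ dΦ _ hu hab _ hζ _ hs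
  obtain ⟨⟨du, hdu⟩, _⟩ := hu
  obtain ⟨z, hz⟩ := hs.exists_isBurgersSolution hT hχL hdu.memLp
  obtain ⟨h1, h2⟩ := hbound u y0 y dy z hz
  refine ⟨h1, fun η h hη hX => ?_⟩
  refine (hs.normP_le hT hζ.smooth.continuous (fun i => (hX.distance_pos i).le)
    (m := |a| + |b| + |η|) (σ := 2 * (|b - a| + 2 * |η|)) ?_ fun i => ?_).trans (by gcongr)
  · refine (hX.sum_le hab hη).trans ?_
    rw [abs_of_nonneg (sub_nonneg.2 hab), abs_of_pos hη]
  · have hm := hX.mem_Icc i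
    refine sq_le_sq' ?_ ?_ <;>
      linarith [hm.1, hm.2, neg_abs_le a, le_abs_self b, le_abs_self η, abs_nonneg a, abs_nonneg b,
        neg_abs_le b, le_abs_self a, neg_abs_le η]
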